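/- **Lemma (Upper bound for Cap).** For $d\ge 1$ and $r>0$ let $S_r^{d-1}=\{x\in\mathbb R^d:\|x\|_2=r\}$ and let $B_r$ be the closed ball of radius $r$ about $0$. Consider the concentric spheres task: the data distribution $\mathcal D$ draws $x\sim U[S_1^{d-1}]$ and an independent uniform $b\in\{-1,1\}$ and returns $x$ if $b=-1$ and $1.3\,x$ if $b=1$; the ground truth is $h(x)=-1$ if $\|x\|_2\le 1.15$ and $h(x)=1$ otherwise. Write $\mathrm{cap}(y,r,t)=B_r\cap\{x:\langle x,y\rangle\ge t\}$, and let $\tau(0.01)\in[0,1]$ be the height $t$ for which $\mathrm{cap}(y,1,t)$ contains a $0.01$-fraction of the uniform measure of $S_1^{d-1}$, for $y\in S_1^{d-1}$ (it exists and is unique for large $d$). $\mathrm{Cap}(0.01)$ is the random set obtained by drawing independently $y\sim U[S_1^{d-1}]$ and $b\sim U\{-1,1\}$ and returning $\mathrm{cap}(y,1.15,\tau(0.01))\setminus B_{1.15/1.3}$ if $b=-1$ and $\mathrm{cap}(y,1.495,1.3\,\tau(0.01))\setminus B_{1.15}$ if $b=1$. For $f:\mathbb R^d\to\{-1,1\}$,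 $\epsilon\ge0$ and $p:\mathbb R^d\to\mathbb R^d$ put $AR(f,\epsilon)=\mathbb P_{X\sim\mathcal D}[\exists\gamma\in B_\epsilon: f(X+\gamma)\ne h(X)]$ and $AR(f,p)=\mathbb P_{X\sim\mathcal D}[f(p(X))\ne h(X)]$. A non-adaptive $q$-bounded adversary $\mathcal A$ with parameter $\epsilon$ is deterministic: it fixes $q$ points (repetitions allowed) in advance, asks for each of them whether $f$ takes the value $1$ there, and as a function of the answers outputs a measurable $p=\mathcal A(f)$ with $\|p(x)-x\|_2\le\epsilon$ for all $x\in\mathbb R^d$. It succeeds on a random set $E$ with approximation constant $\alpha$ and error probability $\kappa$ if, for the classifier $f$ with error set $\{x:f(x)\neq h(x)\}=E$, one has $AR(f,\mathcal A(f))\ge\alpha\,AR(f,\epsilon)$ with probability at least $1-\kappa$ over $E$. *Claim.* There is a function $q(d)=\Theta(d)$ such that for every $d$ larger than an absolute constant there is a non-adaptive $q(d)$-bounded adversary $\mathcal A$ with parameter $\epsilon=\tau(0.01)$ that succeeds on $\mathrm{Cap}(0.01)$ with approximation constant $1/2$ and error probability $0.01$. Moreover $\mathcal A$ can be implemented in $O(d^2)$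 time, in the following sense: there are two real-RAM programs, not depending on $d$ (unit-cost arithmetic, square root, comparison and indirect addressing; a query costs $d+1$ steps; rational constants), such that the first one, given $d$, $q(d)$, $\epsilon$ and the coordinates of the $q(d)$ hard-wired query points, makes exactly the queries of $\mathcal A$ to $f$ and halts after $O(d^2)$ steps, and afterwards the second one computes $\mathcal A(f)(x)$ for any given $x\in\mathbb R^d$ in $O(d)$ steps without further queries, for every classifier $f$. -/

import Mathlib

open MeasureTheory Asymptotics Filter
open scoped ENNReal

noncomputable section

namespace ConcentricSpheres

/-- The space `ℝ^d` with its Euclidean norm. -/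
abbrev Vec (d : ℕ) := EuclideanSpace ℝ (Fin d)

/-! ### Classification tasks, adversarial risk, adversaries

Labels `{-1, 1}` are the units of `ℤ`. -/

/-- `p` moves every point by at most `ε`. -/
def IsPerturbation {d : ℕ} (ε : ℝ) (p : Vec d → Vec d) : Prop :=
  ∀ x, ‖p x - x‖ ≤ ε

/-- `AR(f, ε)`, for the data distribution `D` and the ground truth `h`. -/
def advRisk {d : ℕ} (D : Measure (Vec d)) (h f : Vec d → ℤˣ) (ε : ℝ) : ℝ :=
  D.real {x | ∃ γ ∈ Metric.closedBall (0 : Vec d) ε, f (x + γ) ≠ h x}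

/-- `AR(f, p)`, for the data distribution `D` and the ground truth `h`. -/
def advRiskOf {d : ℕ} (D : Measure (Vec d)) (h f : Vec d → ℤˣ) (p : Vec d → Vec d) : ℝ :=
  D.real {x | f (p x) ≠ h x}

/-- The classifier whose error set with respect to the ground truth `h` is `E`. -/
def classifierOf {d : ℕ} (h : Vec d → ℤˣ) (E : Set (Vec d)) : Vec d → ℤˣ :=
  open Classical in fun x => if x ∈ E then -h x else h x

/-- A deterministic non-adaptive `q`-bounded adversary with parameter `ε`: the points at which
the classifier is queried are fixed in advance, and the (measurable) `ε`-perturbation that is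
put out is a function of the answers to the questions "is `f x = 1`?". -/
structure NonadaptiveAdversary (d q : ℕ) (ε : ℝ) where
  queries : Fin q → Vec d
  output : (Fin q → Bool) → Vec d → Vec d
  isPerturbation : ∀ a, IsPerturbation ε (output a)
  measurable_output : ∀ a, Measurable (output a)

/-- The perturbation that the adversary puts out when it attacks `f`. -/
def NonadaptiveAdversary.attack {d q : ℕ} {ε : ℝ} (A : NonadaptiveAdversary d q ε)
    (f : Vec d → ℤˣ) : Vec d → Vec d :=
  A.output fun i => decide (f (A.queries i) = 1)

/-- The adversary succeeds on the random error set `E ω`, `ω ∼ P`, with approximation constant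
`α` and error probability `κ`. The event of failure is bounded in outer measure, so its
complement has probability at least `1 - κ` whatever its measurability. -/
def NonadaptiveAdversary.SucceedsOn {d q : ℕ} {ε : ℝ} (A : NonadaptiveAdversary d q ε)
    (D : Measure (Vec d)) (h : Vec d → ℤˣ) {Ω : Type*} [MeasurableSpace Ω] (P : Measure Ω)
    (E : Ω → Set (Vec d)) (α κ : ℝ) : Prop :=
  P {ω | ¬ advRiskOf D h (classifierOf h (E ω)) (A.attack (classifierOf h (E ω))) ≥
      α * advRisk D h (classifierOf h (E ω)) ε} ≤ ENNReal.ofReal κ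

/-! ### The concentric spheres task and the distribution `Cap` -/

/-- The uniform probability distribution on the unit sphere, as a measure on `ℝ^d`. -/
def uniformSphere (d : ℕ) : Measure (Vec d) :=
  (((volume : Measure (Vec d)).toSphere Set.univ)⁻¹ • (volume : Measure (Vec d)).toSphere).map
    (Subtype.val : Metric.sphere (0 : Vec d) 1 → Vec d)

/-- A uniformly random element of `{-1, 1}`. -/
def uniformSign : Measure ℤˣ :=
  (1 / 2 : ℝ≥0∞) • Measure.dirac (-1) + (1 / 2 : ℝ≥0∞) • Measure.dirac 1

/-- The data distribution: a uniform point of the sphere of radius `1` (if `b = -1`) or of the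
sphere of radius `1.3` (if `b = 1`). -/
def spheresData (d : ℕ) : Measure (Vec d) :=
  ((uniformSphere d).prod uniformSign).map
    fun z => if z.2 = -1 then z.1 else (1.3 : ℝ) • z.1

/-- The ground truth: `-1` on the closed ball of radius `1.15` and `1` outside of it. -/
def spheresTruth (d : ℕ) : Vec d → ℤˣ :=
  fun x => if ‖x‖ ≤ 1.15 then -1 else 1

/-- `cap(y, r, t)`. -/
def cap {d : ℕ} (y : Vec d) (r t : ℝ) : Set (Vec d) :=
  Metric.closedBall 0 r ∩ {x | inner ℝ x y ≥ t}

/-- `t = τ(δ)`: caps of the unit sphere at height `t ∈ [0, 1]` are a `δ`-fraction of it. -/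
def IsCapHeight (d : ℕ) (δ t : ℝ) : Prop :=
  t ∈ Set.Icc (0 : ℝ) 1 ∧
    ∀ y ∈ Metric.sphere (0 : Vec d) 1, uniformSphere d (cap y 1 t) = ENNReal.ofReal δ

/-- The law of the normal vector `y` and the sign `b` of a random cap. -/
def capLaw (d : ℕ) : Measure (Vec d × ℤˣ) := (uniformSphere d).prod uniformSign

/-- The error set with normal vector `y` and sign `b`, for `t = τ(δ)`. With `(y, b) ∼ capLaw d`
this is the random set `Cap(δ)`. -/
def capSet {d : ℕ} (t : ℝ) (z : Vec d × ℤˣ) : Set (Vec d) :=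
  if z.2 = -1 then cap z.1 1.15 t \ Metric.closedBall 0 (1.15 / 1.3)
  else cap z.1 1.495 (1.3 * t) \ Metric.closedBall 0 1.15

/-! ### A real RAM with query access to a classifier

A machine has integer registers, real registers and real arrays (indirectly addressed through
integer registers). A command is a fixed finite text, independent of the dimension. Arithmetic,
comparison and memory access have unit cost, and a query of a point of `ℝ^d` costs `d + 1`. -/

/-- Memory of the machine. -/
structure Memory where
  int : ℕ → ℕ
  real : ℕ → ℝ
  arr : ℕ → ℕ → ℝ

namespace Memory

def setInt (s : Memory) (i n : ℕ) : Memory := { s with int := Function.update s.int i n }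

def setReal (s : Memory) (r : ℕ) (v : ℝ) : Memory :=
  { s with real := Function.update s.real r v }

def setArr (s : Memory) (a n : ℕ) (v : ℝ) : Memory :=
  { s with arr := Function.update s.arr a (Function.update (s.arr a) n v) }

/-- The vector in the cells `n, …, n + d - 1` of array `a`. -/
def vec (s : Memory) (d a n : ℕ) : Vec d := WithLp.toLp 2 fun k : Fin d => s.arr a (n + k)

end Memory

/-- Instructions other than queries. -/
inductive Instr where
  | intConst (i n : ℕ)
  | intAdd (i j k : ℕ)
  | intSub (i j k : ℕ)
  | realConst (r : ℕ) (c : ℚ)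
  | realAdd (r u v : ℕ)
  | realSub (r u v : ℕ)
  | realMul (r u v : ℕ)
  | realDiv (r u v : ℕ)
  | realSqrt (r u : ℕ)
  /-- real register `r` becomes the cell of array `a` that integer register `i` points to -/
  | load (r a i : ℕ)
  /-- the cell of array `a` that integer register `i` points to becomes real register `r` -/
  | store (a i r : ℕ)

def Instr.apply : Instr → Memory → Memory
  | intConst i n, s => s.setInt i n
  | intAdd i j k, s => s.setInt i (s.int j + s.int k)
  | intSub i j k, s => s.setInt i (s.int j - s.int k)
  | realConst r c, s => s.setReal r c
  | realAdd r u v, s => s.setReal r (s.real u + s.real v)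
  | realSub r u v, s => s.setReal r (s.real u - s.real v)
  | realMul r u v, s => s.setReal r (s.real u * s.real v)
  | realDiv r u v, s => s.setReal r (s.real u / s.real v)
  | realSqrt r u, s => s.setReal r (Real.sqrt (s.real u))
  | load r a i, s => s.setReal r (s.arr a (s.int i))
  | store a i r, s => s.setArr a (s.int i) (s.real r)

/-- Comparisons of two integer or of two real registers. -/
inductive Test where
  | intLt (i j : ℕ)
  | realLt (r u : ℕ)

def Test.Holds : Test → Memory → Prop
  | intLt i j, s => s.int i < s.int j
  | realLt r u, s => s.real r < s.real u

/-- Commands. `query a i j` asks whether the classifier takes the value `1` at the point whose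
coordinates start at the cell of array `a` that integer register `i` points to, and puts the
answer (`1` for yes, `0` for no) into integer register `j`. -/
inductive Command where
  | skip
  | instr (c : Instr)
  | query (a i j : ℕ)
  | seq (c₁ c₂ : Command)
  | cond (t : Test) (c₁ c₂ : Command)
  | loop (t : Test) (c : Command)

/-- `Exec f c s s' Q n`: with query access to `f`, command `c` started in memory `s` halts in
memory `s'`, asks exactly the queries `Q` (in this order), and takes `n` steps. -/
inductive Exec {d : ℕ} (f : Vec d → ℤˣ) :
    Command → Memory → Memory → List (Vec d) → ℕ → Prop where
  | skip (s : Memory) : Exec f .skip s s [] 0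
  | instr (c : Instr) (s : Memory) : Exec f (.instr c) s (c.apply s) [] 1
  | query (a i j : ℕ) (s : Memory) :
      Exec f (.query a i j) s
        (s.setInt j (if f (s.vec d a (s.int i)) = 1 then 1 else 0))
        [s.vec d a (s.int i)] (d + 1)
  | seq {c₁ c₂ : Command} {s₀ s₁ s₂ : Memory} {Q₁ Q₂ : List (Vec d)} {n₁ n₂ : ℕ}
      (h₁ : Exec f c₁ s₀ s₁ Q₁ n₁) (h₂ : Exec f c₂ s₁ s₂ Q₂ n₂) :
      Exec f (.seq c₁ c₂) s₀ s₂ (Q₁ ++ Q₂) (n₁ + n₂)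
  | condTrue {t : Test} {c₁ c₂ : Command} {s s' : Memory} {Q : List (Vec d)} {n : ℕ}
      (ht : t.Holds s) (h : Exec f c₁ s s' Q n) : Exec f (.cond t c₁ c₂) s s' Q (n + 1)
  | condFalse {t : Test} {c₁ c₂ : Command} {s s' : Memory} {Q : List (Vec d)} {n : ℕ}
      (ht : ¬ t.Holds s) (h : Exec f c₂ s s' Q n) : Exec f (.cond t c₁ c₂) s s' Q (n + 1)
  | loopDone {t : Test} {c : Command} {s : Memory} (ht : ¬ t.Holds s) :
      Exec f (.loop t c) s s [] 1
  | loopStep {t : Test} {c : Command} {s₀ s₁ s₂ : Memory} {Q₁ Q₂ : List (Vec d)} {n₁ n₂ : ℕ}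
      (ht : t.Holds s₀) (h₁ : Exec f c s₀ s₁ Q₁ n₁) (h₂ : Exec f (.loop t c) s₁ s₂ Q₂ n₂) :
      Exec f (.loop t c) s₀ s₂ (Q₁ ++ Q₂) (n₁ + n₂ + 1)

/-- The memory before preprocessing: it holds `d`, `q`, `ε` and, in array `0`, the coordinates
of the `q` hard-wired query points one after the other. Everything else is `0`. -/
def startMemory {d q : ℕ} (ε : ℝ) (x : Fin q → Vec d) : Memory where
  int i := if i = 0 then d else if i = 1 then q else 0
  real r := if r = 0 then ε else 0
  arr a n :=
    if h : a = 0 ∧ n < q * d then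
      x ⟨n / d, Nat.div_lt_of_lt_mul (by rw [Nat.mul_comm]; exact h.2)⟩
        ⟨n % d, Nat.mod_lt _ (Nat.pos_of_ne_zero fun hd => by simp [hd] at h)⟩
    else 0

/-- Put the coordinates of `x` into array `1`. -/
def Memory.withInput {d : ℕ} (s : Memory) (x : Vec d) : Memory :=
  { s with
    arr := Function.update s.arr 1 fun n => if h : n < d then x ⟨n, h⟩ else 0 }

/-- The adversary is implemented by the commands `pre` and `eval` in time `(T, T')`: on every
classifier `f`, the preprocessing `pre` asks exactly the queries of the adversary and halts after
at most `T` steps; from then on, without further queries, `eval` computes the value at any given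
point `x` of the perturbation that the adversary puts out, in at most `T'` steps, and leaves it in
array `2`. -/
def NonadaptiveAdversary.ImplementedBy {d q : ℕ} {ε : ℝ} (A : NonadaptiveAdversary d q ε)
    (pre eval : Command) (T T' : ℕ) : Prop :=
  ∀ f : Vec d → ℤˣ, ∃ (s : Memory) (n : ℕ), n ≤ T ∧
    Exec f pre (startMemory ε A.queries) s (List.ofFn A.queries) n ∧
    ∀ x : Vec d, ∃ (s' : Memory) (n' : ℕ), n' ≤ T' ∧
      Exec f eval (s.withInput x) s' [] n' ∧ s'.vec d 2 0 = A.attack f x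

end ConcentricSpheres

end

open ConcentricSpheres

open scoped Pointwise

namespace ConcentricSpheres

/-! ### Running time of loops -/

/-! The adversary estimates the normal `y` of the cap by averaging and shifts every point in the
estimated direction. Fix `m = 10^9 d` points `x i` of the unit sphere and query each `x i` together
with `1.3 • x i`. Whatever the sign `b`, one point of the pair is misclassified if `⟨x i, y⟩ ≥ t`,
and neither is otherwise (`query_answers_iff`). So the answers reveal, up to the factor `1.3`, the
sum `S` of the `x i` above height `t`, and the output is the shift by `t S / ‖S‖`.

For independent uniform `x i`, about `m / 100` points are counted. Each adds at least `t` to `⟨S,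
y⟩`, which is therefore at least `0.005 t m` with high probability. The components orthogonal to `y`
are centred, by symmetry, so their sum has mean square at most `m / 100`. Since `t` is of order `1 /
√d`, the ratio of `(t m)²` to `m` is of order `m / d`, and a large multiple of `d` samples aligns
`S` with `y` with probability `0.99` (`measure_not_isAligned_le`). By Fubini, one fixed sample
serves all but one percent of the directions (`exists_sample`); this makes the adversary
deterministic.

Let `R` be the radius of the attacked sphere and `C(s)` the fraction of the unit sphere above height
`s`. No perturbation of size `t` achieves more than `C(t (R - 1) / R) / 2`, and the shift achieves
at least `C(t (R - 1 + η) / R) / 2` with `η = 1/2000`. One-dimensional marginals have density at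
most `√d` near the equator (`uniformSphere_slab_le`) and `t √d ≤ 10`, so `C` drops by at most `10 η
= 0.005` between the two heights. This is half of `C(t) = 0.01`, hence at most half of `C(t (R - 1)
/ R)` (`half_mul_advRisk_le`).

Each pair of queries costs `O(d)` steps, so the preprocessing takes `O(d²)`; an evaluation is one
scaled vector addition. -/

theorem Exec.loop_of_invariant {d : ℕ} {f : Vec d → ℤˣ} {t : Test} {c : Command}
    (I : ℕ → Memory → Prop) (Q : ℕ → List (Vec d)) (n B : ℕ)
    (hstep : ∀ k < n, ∀ s, I k s → t.Holds s ∧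
      ∃ s' b, b ≤ B ∧ Exec f c s s' (Q k) b ∧ I (k + 1) s')
    (hdone : ∀ s, I n s → ¬ t.Holds s) (s : Memory) (hs : I 0 s) :
    ∃ s' b, b ≤ n * (B + 1) + 1 ∧
      Exec f (.loop t c) s s' ((List.range n).flatMap Q) b ∧ I n s' := by
  induction n generalizing I Q s with
  | zero => exact ⟨s, 1, by simp, by simpa using Exec.loopDone (hdone s hs), hs⟩
  | succ n ih =>
    obtain ⟨ht, s₁, b₁, hb₁, he₁, hI₁⟩ := hstep 0 (Nat.succ_pos n) s hs
    obtain ⟨s₂, b₂, hb₂, he₂, hI₂⟩ := ih (fun k => I (k + 1)) (fun k => Q (k + 1))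
      (fun k hk s hs => hstep (k + 1) (Nat.succ_lt_succ hk) s hs) hdone s₁ hI₁
    -- Each of the `n` iterations pays one step for its test, and the final failing test pays one
    -- more.
    refine ⟨s₂, b₁ + b₂ + 1, by nlinarith, ?_, hI₂⟩
    rw [List.range_succ_eq_map, List.flatMap_cons, List.flatMap_map]
    exact Exec.loopStep ht he₁ he₂

/-! ### The program -/

/-- Sequential composition of a list of commands. -/
def Command.block : List Command → Command
  | [] => .skip
  | c :: l => .seq c (Command.block l)

/-- Add the vector of array `0` at pointer `4` to the vector in array `3`. -/
def addVector : Command :=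
  .seq (.instr (.intConst 5 0)) (.loop (.intLt 5 0) (.block [
    .instr (.intAdd 8 4 5), .instr (.load 1 0 8), .instr (.load 2 3 5),
    .instr (.realAdd 2 2 1), .instr (.store 3 5 2), .instr (.intAdd 5 5 2)]))

/-- Process two consecutive query points. -/
def queryPair : Command := .block [
  .query 0 4 6, .instr (.intAdd 4 4 0), .query 0 4 7,
  -- Answer `0` followed by answer `1` is the correct labelling of a point of the inner sphere and
  -- its multiple on the outer one; any other pair of answers reveals an error.
  .cond (.intLt 6 7) .skip addVector,
  .instr (.intAdd 4 4 0), .instr (.intAdd 3 3 2), .instr (.intAdd 3 3 2)]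

/-- Real register `3` becomes the sum of the squares of the vector in array `3`. -/
def sumSquares : Command :=
  .seq (.instr (.intConst 5 0)) (.loop (.intLt 5 0) (.block [
    .instr (.load 1 3 5), .instr (.realMul 1 1 1), .instr (.realAdd 3 3 1),
    .instr (.intAdd 5 5 2)]))

/-- The preprocessing: sum up the query points at which the classifier errs, and compute the
factor that scales this sum to norm `ε`. -/
def preprocess : Command := .block [
  -- Integer register `2` serves as the constant one for increments. Register `3` counts the queries
  -- made and register `4` points to the next query point; both rely on the initial value zero.
  .instr (.intConst 2 1), .loop (.intLt 3 1) queryPair, sumSquares,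
  .instr (.realSqrt 3 3), .instr (.realDiv 4 0 3)]

/-- The evaluation: add the scaled sum to the input. -/
def evaluate : Command :=
  .seq (.instr (.intConst 5 0)) (.loop (.intLt 5 0) (.block [
    .instr (.load 1 3 5), .instr (.realMul 1 4 1), .instr (.load 2 1 5),
    .instr (.realAdd 2 2 1), .instr (.store 2 5 2), .instr (.intAdd 5 5 2)]))

/-! ### Correctness of the program -/

theorem exec_addVector {d : ℕ} (f : Vec d → ℤˣ) (s : Memory) (h0 : s.int 0 = d)
    (h2 : s.int 2 = 1) :
    ∃ s' b, b ≤ 7 * d + 2 ∧ Exec f addVector s s' [] b ∧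
      (∀ i, i ≠ 5 → i ≠ 8 → s'.int i = s.int i) ∧
      (∀ r, r ≠ 1 → r ≠ 2 → s'.real r = s.real r) ∧
      (∀ a, a ≠ 3 → s'.arr a = s.arr a) ∧
      ∀ k, k < d → s'.arr 3 k = s.arr 3 k + s.arr 0 (s.int 4 + k) := by
  obtain ⟨s', b, hb, he, hI⟩ := Exec.loop_of_invariant (f := f) (t := .intLt 5 0)
    (c := .block [
      .instr (.intAdd 8 4 5), .instr (.load 1 0 8), .instr (.load 2 3 5),
      .instr (.realAdd 2 2 1), .instr (.store 3 5 2), .instr (.intAdd 5 5 2)])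
    (fun k s' => s'.int 5 = k ∧ (∀ i, i ≠ 5 → i ≠ 8 → s'.int i = s.int i) ∧
      (∀ r, r ≠ 1 → r ≠ 2 → s'.real r = s.real r) ∧
      (∀ a, a ≠ 3 → s'.arr a = s.arr a) ∧
      -- Stated for all `j`, so that the cells not yet reached are known to be unchanged.
      ∀ j, s'.arr 3 j = s.arr 3 j + if j < k then s.arr 0 (s.int 4 + j) else 0)
    (fun _ => []) d 6
    (by
      rintro k hk s₁ ⟨h5, hint, hreal, harr, h3⟩
      refine ⟨by simp [Test.Holds, h5, hint 0, h0, hk], _, 6, le_rfl,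
        .seq (.instr _ _) <| .seq (.instr _ _) <| .seq (.instr _ _) <| .seq (.instr _ _) <|
          .seq (.instr _ _) <| .seq (.instr _ _) <| .skip _, ?_, ?_, ?_, ?_, ?_⟩
      · simp [Instr.apply, Memory.setInt, Memory.setReal, Memory.setArr, Function.update, h5,
          hint 2, h2]
      · intro i h h'
        simp [Instr.apply, Memory.setInt, Memory.setReal, Memory.setArr, Function.update,
          h, h', hint]
      · intro r h h'
        simp [Instr.apply, Memory.setInt, Memory.setReal, Memory.setArr, Function.update,
          h, h', hreal]
      · intro a h
        simp [Instr.apply, Memory.setInt, Memory.setReal, Memory.setArr, Function.update,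
          h, harr]
      · intro j
        rcases lt_trichotomy j k with h | h | h
        · simp [Instr.apply, Memory.setInt, Memory.setReal, Memory.setArr, Function.update, h5,
            h3, h, h.ne, h.trans (Nat.lt_succ_self k)]
        · subst h
          simp [Instr.apply, Memory.setInt, Memory.setReal, Memory.setArr, Function.update, h5,
            h3, hint 4, harr 0]
        · simp [Instr.apply, Memory.setInt, Memory.setReal, Memory.setArr, Function.update, h5,
            h3, h.ne', h.not_gt, show ¬ j < k + 1 by omega])
    (by
      rintro s₁ ⟨h5, hint, -⟩
      simp [Test.Holds, h5, hint 0, h0])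
    (s.setInt 5 0)
    (by
      refine ⟨by simp [Memory.setInt], fun i h _ => by simp [Memory.setInt, h],
        fun _ _ _ => rfl, fun _ _ => rfl, fun j => by simp [Memory.setInt]⟩)
  obtain ⟨-, hint, hreal, harr, h3⟩ := hI
  refine ⟨s', 1 + b, by omega, ?_, hint, hreal, harr, fun k hk => by rw [h3 k, if_pos hk]⟩
  have := Exec.seq (Exec.instr (f := f) (.intConst 5 0) s) he
  rwa [show (List.range d).flatMap (fun _ => ([] : List (Vec d))) = [] by simp] at this

theorem exec_sumSquares {d : ℕ} (f : Vec d → ℤˣ) (s : Memory) (h0 : s.int 0 = d)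
    (h2 : s.int 2 = 1) (h3 : s.real 3 = 0) :
    ∃ s' b, b ≤ 5 * d + 2 ∧ Exec f sumSquares s s' [] b ∧
      (∀ i, i ≠ 5 → s'.int i = s.int i) ∧
      (∀ r, r ≠ 1 → r ≠ 3 → s'.real r = s.real r) ∧ s'.arr = s.arr ∧
      s'.real 3 = ∑ k ∈ Finset.range d, s.arr 3 k * s.arr 3 k := by
  obtain ⟨s', b, hb, he, hI⟩ := Exec.loop_of_invariant (f := f) (t := .intLt 5 0)
    (c := .block [
      .instr (.load 1 3 5), .instr (.realMul 1 1 1), .instr (.realAdd 3 3 1),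
      .instr (.intAdd 5 5 2)])
    (fun k s' => s'.int 5 = k ∧ (∀ i, i ≠ 5 → s'.int i = s.int i) ∧
      (∀ r, r ≠ 1 → r ≠ 3 → s'.real r = s.real r) ∧ s'.arr = s.arr ∧
      s'.real 3 = ∑ k ∈ Finset.range k, s.arr 3 k * s.arr 3 k)
    (fun _ => []) d 4
    (by
      rintro k hk s₁ ⟨h5, hint, hreal, harr, h3⟩
      refine ⟨by simp [Test.Holds, h5, hint 0, h0, hk], _, 4, le_rfl,
        .seq (.instr _ _) <| .seq (.instr _ _) <| .seq (.instr _ _) <| .seq (.instr _ _) <|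
          .skip _, ?_, ?_, ?_, ?_, ?_⟩
      · simp [Instr.apply, Memory.setInt, Memory.setReal, Function.update, h5, hint 2, h2]
      · intro i h
        simp [Instr.apply, Memory.setInt, Memory.setReal, Function.update, h, hint]
      · intro r h h'
        simp [Instr.apply, Memory.setInt, Memory.setReal, Function.update, h, h', hreal]
      · simp [Instr.apply, Memory.setInt, Memory.setReal, harr]
      · simp [Instr.apply, Memory.setInt, Memory.setReal, Function.update, harr, h5, h3,
          Finset.sum_range_succ])
    (by
      rintro s₁ ⟨h5, hint, -⟩
      simp [Test.Holds, h5, hint 0, h0])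
    (s.setInt 5 0)
    (by
      refine ⟨by simp [Memory.setInt], fun i h => by simp [Memory.setInt, h],
        fun _ _ _ => rfl, rfl, by simp [Memory.setInt, h3]⟩)
  obtain ⟨-, hint, hreal, harr, h3⟩ := hI
  refine ⟨s', 1 + b, by omega, ?_, hint, hreal, harr, h3⟩
  have := Exec.seq (Exec.instr (f := f) (.intConst 5 0) s) he
  rwa [show (List.range d).flatMap (fun _ => ([] : List (Vec d))) = [] by simp] at this

theorem exec_evaluate {d : ℕ} (f : Vec d → ℤˣ) (s : Memory) (h0 : s.int 0 = d)
    (h2 : s.int 2 = 1) :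
    ∃ s' b, b ≤ 7 * d + 2 ∧ Exec f evaluate s s' [] b ∧
      ∀ k, k < d → s'.arr 2 k = s.arr 1 k + s.real 4 * s.arr 3 k := by
  obtain ⟨s', b, hb, he, hI⟩ := Exec.loop_of_invariant (f := f) (t := .intLt 5 0)
    (c := .block [
      .instr (.load 1 3 5), .instr (.realMul 1 4 1), .instr (.load 2 1 5),
      .instr (.realAdd 2 2 1), .instr (.store 2 5 2), .instr (.intAdd 5 5 2)])
    (fun k s' => s'.int 5 = k ∧ s'.int 0 = d ∧ s'.int 2 = 1 ∧ s'.real 4 = s.real 4 ∧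
      s'.arr 1 = s.arr 1 ∧ s'.arr 3 = s.arr 3 ∧
      ∀ j, j < k → s'.arr 2 j = s.arr 1 j + s.real 4 * s.arr 3 j)
    (fun _ => []) d 6
    (by
      rintro k hk s₁ ⟨h5, hd, h1, hr, ha1, ha3, ha2⟩
      refine ⟨by simp [Test.Holds, h5, hd, hk], _, 6, le_rfl,
        .seq (.instr _ _) <| .seq (.instr _ _) <| .seq (.instr _ _) <| .seq (.instr _ _) <|
          .seq (.instr _ _) <| .seq (.instr _ _) <| .skip _, ?_, ?_, ?_, ?_, ?_, ?_, ?_⟩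
      · simp [Instr.apply, Memory.setInt, Memory.setReal, Memory.setArr, Function.update, h5, h1]
      · simp [Instr.apply, Memory.setInt, Memory.setReal, Memory.setArr, Function.update, hd]
      · simp [Instr.apply, Memory.setInt, Memory.setReal, Memory.setArr, Function.update, h1]
      · simp [Instr.apply, Memory.setInt, Memory.setReal, Memory.setArr, Function.update, hr]
      · simp [Instr.apply, Memory.setInt, Memory.setReal, Memory.setArr, Function.update, ha1]
      · simp [Instr.apply, Memory.setInt, Memory.setReal, Memory.setArr, Function.update, ha3]
      · intro j hj
        rcases (Nat.lt_succ_iff.1 hj).lt_or_eq with h | h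
        · simp [Instr.apply, Memory.setInt, Memory.setReal, Memory.setArr, Function.update, h5,
            h.ne, ha2 j h]
        · simp [Instr.apply, Memory.setInt, Memory.setReal, Memory.setArr, Function.update, h5,
            h, ha1, ha3, hr])
    (by
      rintro s₁ ⟨h5, hd, -⟩
      simp [Test.Holds, h5, hd])
    (s.setInt 5 0)
    ⟨by simp [Memory.setInt], by simp [Memory.setInt, h0], by simp [Memory.setInt, h2],
      rfl, rfl, rfl, fun j hj => by omega⟩
  refine ⟨s', 1 + b, by omega, ?_, hI.2.2.2.2.2.2⟩
  have := Exec.seq (Exec.instr (f := f) (.intConst 5 0) s) he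
  rwa [show (List.range d).flatMap (fun _ => ([] : List (Vec d))) = [] by simp] at this

theorem exec_queryPair {d : ℕ} (f : Vec d → ℤˣ) (s : Memory) (z z' : Vec d) (h0 : s.int 0 = d)
    (h2 : s.int 2 = 1) (hz : ∀ k : Fin d, s.arr 0 (s.int 4 + k) = z k)
    (hz' : ∀ k : Fin d, s.arr 0 (s.int 4 + d + k) = z' k) :
    ∃ s' b, b ≤ 9 * d + 9 ∧ Exec f queryPair s s' [z, z'] b ∧
      s'.int 0 = d ∧ s'.int 1 = s.int 1 ∧ s'.int 2 = 1 ∧ s'.int 3 = s.int 3 + 2 ∧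
      s'.int 4 = s.int 4 + 2 * d ∧
      (∀ r, r ≠ 1 → r ≠ 2 → s'.real r = s.real r) ∧ s'.arr 0 = s.arr 0 ∧
      ∀ k : Fin d, s'.arr 3 k =
        s.arr 3 k + (if f z ≠ 1 ∧ f z' = 1 then (0 : Vec d) else z') k := by
  have hv : s.vec d 0 (s.int 4) = z := by
    ext k; simpa [Memory.vec] using hz k
  set s₁ := s.setInt 6 (if f z = 1 then 1 else 0) with hs₁
  have e₁ : Exec f (.query 0 4 6) s s₁ [z] (d + 1) := by
    have := Exec.query (f := f) 0 4 6 s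
    rwa [hv] at this
  set s₂ := Instr.apply (.intAdd 4 4 0) s₁ with hs₂
  have e₂ : Exec f (.instr (.intAdd 4 4 0)) s₁ s₂ [] 1 := .instr _ _
  have h4 : s₂.int 4 = s.int 4 + d := by
    simp [hs₂, hs₁, Instr.apply, Memory.setInt, Function.update, h0]
  have ha₂ : s₂.arr = s.arr := rfl
  have hv' : s₂.vec d 0 (s₂.int 4) = z' := by
    ext k; simpa [Memory.vec, h4, ha₂] using hz' k
  set s₃ := s₂.setInt 7 (if f z' = 1 then 1 else 0) with hs₃
  have e₃ : Exec f (.query 0 4 7) s₂ s₃ [z'] (d + 1) := by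
    have := Exec.query (f := f) 0 4 7 s₂
    rwa [hv'] at this
  have hint₃ : ∀ i, i ≠ 4 → i ≠ 6 → i ≠ 7 → s₃.int i = s.int i := by
    intro i h h' h''
    simp [hs₃, hs₂, hs₁, Instr.apply, Memory.setInt, Function.update, h, h', h'']
  have h4₃ : s₃.int 4 = s.int 4 + d := by
    simp [hs₃, Memory.setInt, Function.update, h4]
  have ha₃ : s₃.arr = s.arr := rfl
  have hr₃ : s₃.real = s.real := rfl
  have htest : (Test.intLt 6 7).Holds s₃ ↔ f z ≠ 1 ∧ f z' = 1 := by
    simp only [Test.Holds, hs₃, hs₂, hs₁, Instr.apply, Memory.setInt, Function.update]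
    by_cases h : f z = 1 <;> by_cases h' : f z' = 1 <;> simp [h, h']
  obtain ⟨s₄, b, hb, e₄, hint₄, hreal₄, harr₄, h3₄⟩ : ∃ s₄ b, b ≤ 7 * d + 3 ∧
      Exec f (.cond (.intLt 6 7) .skip addVector) s₃ s₄ [] b ∧
      (∀ i, i ≠ 5 → i ≠ 8 → s₄.int i = s₃.int i) ∧
      (∀ r, r ≠ 1 → r ≠ 2 → s₄.real r = s₃.real r) ∧ s₄.arr 0 = s₃.arr 0 ∧
      ∀ k : Fin d, s₄.arr 3 k =
        s₃.arr 3 k + (if f z ≠ 1 ∧ f z' = 1 then (0 : Vec d) else z') k := by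
    by_cases h : f z ≠ 1 ∧ f z' = 1
    · exact ⟨s₃, 1, by omega, .condTrue (htest.2 h) (.skip _), fun _ _ _ => rfl,
        fun _ _ _ => rfl, rfl, fun k => by rw [if_pos h]; simp⟩
    · obtain ⟨s₄, b, hb, he, h₁, h₂, h₃, h₄⟩ := exec_addVector f s₃
        (by rw [hint₃ 0 (by simp) (by simp) (by simp), h0])
        (by rw [hint₃ 2 (by simp) (by simp) (by simp), h2])
      refine ⟨s₄, b + 1, by omega, .condFalse (fun h' => h (htest.1 h')) he, h₁, h₂,
        h₃ 0 (by simp), fun k => ?_⟩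
      rw [if_neg h, h₄ k k.2, h4₃, ha₃, hz' k]
  refine ⟨_, (d + 1) + (1 + ((d + 1) + (b + (1 + (1 + (1 + 0)))))), by omega,
    .seq e₁ <| .seq e₂ <| .seq e₃ <| .seq e₄ <| .seq (.instr _ _) <| .seq (.instr _ _) <|
      .seq (.instr _ _) <| .skip _, ?_, ?_, ?_, ?_, ?_, ?_, ?_, ?_⟩
  · simp [Instr.apply, Memory.setInt, Function.update, hint₄ 0, hint₃ 0, h0]
  · simp [Instr.apply, Memory.setInt, Function.update, hint₄ 1, hint₃ 1]
  · simp [Instr.apply, Memory.setInt, Function.update, hint₄ 2, hint₃ 2, h2]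
  · simp [Instr.apply, Memory.setInt, Function.update, hint₄ 2, hint₃ 2, h2, hint₄ 3, hint₃ 3]
  · simp [Instr.apply, Memory.setInt, Function.update, hint₄ 4, h4₃, hint₄ 0, hint₃ 0, h0]
    omega
  · intro r h h'
    simp [Instr.apply, Memory.setInt, hreal₄ r h h', hr₃]
  · simp [Instr.apply, Memory.setInt, harr₄, ha₃]
  · intro k
    rw [← ha₃, ← h3₄ k]
    simp [Instr.apply, Memory.setInt]

/-- The sum of the query points of a sequence of pairs at which the classifier errs. -/
def errorSum {d : ℕ} (z : ℕ → Vec d) (a : ℕ → Bool) (m : ℕ) : Vec d :=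
  ∑ i ∈ Finset.range m, if a (2 * i) = false ∧ a (2 * i + 1) = true then 0 else z (2 * i + 1)

/-- Matches the list of all queries with the pairs in which the loop of `preprocess` asks them. -/
theorem ofFn_two_mul {α : Type*} (z : ℕ → α) (m : ℕ) :
    (List.ofFn fun i : Fin (2 * m) => z i) =
      (List.range m).flatMap fun k => [z (2 * k), z (2 * k + 1)] := by
  induction m with
  | zero => simp
  | succ m ih =>
    rw [List.range_succ, List.flatMap_append, ← ih]
    rw [show 2 * (m + 1) = 2 * m + 1 + 1 by ring, List.ofFn_succ_last, List.ofFn_succ_last]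
    simp

theorem exec_preprocess {d m : ℕ} (f : Vec d → ℤˣ) (z : ℕ → Vec d) (ε : ℝ) :
    ∃ s b, b ≤ m * (9 * d + 10) + 5 * d + 6 ∧
      Exec f preprocess (startMemory ε fun i : Fin (2 * m) => z i) s
        (List.ofFn fun i : Fin (2 * m) => z i) b ∧
      s.int 0 = d ∧ s.int 2 = 1 ∧
      (∀ k : Fin d, s.arr 3 k = errorSum z (fun n => decide (f (z n) = 1)) m k) ∧
      s.real 4 = ε / ‖errorSum z (fun n => decide (f (z n) = 1)) m‖ := by
  set S := errorSum z (fun n => decide (f (z n) = 1)) with hS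
  set s₀ := startMemory ε fun i : Fin (2 * m) => z i with hs₀
  have harr₀ : ∀ i < 2 * m, ∀ k : Fin d, s₀.arr 0 (i * d + k) = z i k := by
    intro i hi k
    have hk := k.2
    have hlt : i * d + k < 2 * m * d := by nlinarith
    have hdiv : (i * d + k) / d = i := by
      rw [mul_comm, Nat.mul_add_div (by omega), Nat.div_eq_of_lt hk, add_zero]
    have hmod : (i * d + k) % d = k := by
      rw [mul_comm, Nat.mul_add_mod, Nat.mod_eq_of_lt hk]
    simp [hs₀, startMemory, hlt, hdiv, hmod]
  obtain ⟨s₁, b₁, hb₁, e₁, h3, h4, h0, h1, h2, hreal, ha0, ha3⟩ :=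
    Exec.loop_of_invariant (f := f) (t := .intLt 3 1) (c := queryPair)
      (fun k s => s.int 3 = 2 * k ∧ s.int 4 = 2 * k * d ∧ s.int 0 = d ∧ s.int 1 = 2 * m ∧
        s.int 2 = 1 ∧ (∀ r, r ≠ 1 → r ≠ 2 → s.real r = s₀.real r) ∧ s.arr 0 = s₀.arr 0 ∧
        ∀ j : Fin d, s.arr 3 j = S k j)
      (fun k => [z (2 * k), z (2 * k + 1)]) m (9 * d + 9)
      (by
        rintro k hk s ⟨h3, h4, h0, h1, h2, hreal, ha0, ha3⟩
        obtain ⟨s', b, hb, he, h0', h1', h2', h3', h4', hreal', ha0', ha3'⟩ :=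
          exec_queryPair f s (z (2 * k)) (z (2 * k + 1)) h0 h2
            (fun j => by rw [h4, ha0, harr₀ _ (by omega)])
            (fun j => by
              rw [h4, ha0, show 2 * k * d + d = (2 * k + 1) * d by ring, harr₀ _ (by omega)])
        refine ⟨by simp [Test.Holds, h3, h1, hk], s', b, hb, he, by omega,
          by rw [h4', h4]; ring, h0', by rw [h1', h1], h2', fun r h h' => by
            rw [hreal' r h h', hreal r h h'], by rw [ha0', ha0], fun j => ?_⟩
        rw [ha3' j, ha3 j, hS, errorSum, errorSum, Finset.sum_range_succ]
        simp)
      (by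
        rintro s ⟨h3, -, -, h1, -⟩
        simp [Test.Holds, h3, h1])
      (Instr.apply (.intConst 2 1) s₀)
      ⟨by simp [Instr.apply, Memory.setInt, hs₀, startMemory],
        by simp [Instr.apply, Memory.setInt, hs₀, startMemory],
        by simp [Instr.apply, Memory.setInt, hs₀, startMemory],
        by simp [Instr.apply, Memory.setInt, hs₀, startMemory],
        by simp [Instr.apply, Memory.setInt], fun _ _ _ => rfl, rfl,
        fun j => by simp [Instr.apply, Memory.setInt, hs₀, startMemory, hS, errorSum]⟩
  obtain ⟨s₂, b₂, hb₂, e₂, hint₂, hreal₂, harr₂, hsum⟩ := exec_sumSquares f s₁ h0 h2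
    (by rw [hreal 3 (by simp) (by simp)]; simp [hs₀, startMemory])
  have hnorm : Real.sqrt (s₂.real 3) = ‖S m‖ := by
    rw [hsum, EuclideanSpace.norm_eq, ← Fin.sum_univ_eq_sum_range fun k => s₁.arr 3 k * s₁.arr 3 k]
    congr 1
    refine Finset.sum_congr rfl fun k _ => ?_
    rw [ha3 k, Real.norm_eq_abs, sq_abs, sq]
  refine ⟨Instr.apply (.realDiv 4 0 3) (Instr.apply (.realSqrt 3 3) s₂),
    1 + (b₁ + (b₂ + (1 + (1 + 0)))), ?_, ?_, ?_, ?_, ?_, ?_⟩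
  · have : m * (9 * d + 9 + 1) = m * (9 * d + 10) := rfl
    omega
  · have := Exec.seq (.instr (f := f) (.intConst 2 1) s₀) <| .seq e₁ <| .seq e₂ <|
      .seq (.instr (.realSqrt 3 3) _) <| .seq (.instr (.realDiv 4 0 3) _) <| .skip _
    rw [ofFn_two_mul]
    simp only [List.nil_append, List.append_nil] at this
    exact this
  · simp [Instr.apply, Memory.setReal, hint₂ 0, h0]
  · simp [Instr.apply, Memory.setReal, hint₂ 2, h2]
  · intro k
    simp [Instr.apply, Memory.setReal, harr₂, ha3]
  · simp [Instr.apply, Memory.setReal, Function.update, hnorm, hreal₂ 0, hreal 0]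
    simp [hs₀, startMemory]

/-! ### The adversary -/

/-- The adversary that shifts every point by `ε` in the direction of the sum of the query points
at which the classifier errs. -/
noncomputable def shiftAdversary {d : ℕ} (m : ℕ) {ε : ℝ} (hε : 0 ≤ ε) (z : ℕ → Vec d) :
    NonadaptiveAdversary d (2 * m) ε where
  queries i := z i
  output a x :=
    -- The default answer `false` is never read, since `errorSum` only looks at indices below `2 *
    -- m`. If `S = 0`, division by zero makes the shift zero, here and in the program.
    let S := errorSum z (fun n => if h : n < 2 * m then a ⟨n, h⟩ else false) m
    x + (ε / ‖S‖) • S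
  isPerturbation a x := by
    simp only [add_sub_cancel_left, norm_smul, norm_div, norm_norm, Real.norm_of_nonneg hε]
    exact mul_comm_div ε _ _ ▸ mul_le_of_le_one_right hε (div_self_le_one _)
  measurable_output a := by fun_prop

theorem shiftAdversary_attack {d m : ℕ} {ε : ℝ} (hε : 0 ≤ ε) (z : ℕ → Vec d) (f : Vec d → ℤˣ)
    (x : Vec d) :
    (shiftAdversary m hε z).attack f x =
      x + (ε / ‖errorSum z (fun n => decide (f (z n) = 1)) m‖) •
        errorSum z (fun n => decide (f (z n) = 1)) m := by
  have h : errorSum z (fun n => if h : n < 2 * m then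
      decide (f ((shiftAdversary m hε z).queries ⟨n, h⟩) = 1) else false) m =
      errorSum z (fun n => decide (f (z n) = 1)) m := by
    refine Finset.sum_congr rfl fun i hi => ?_
    have hi := Finset.mem_range.1 hi
    simp only [show 2 * i < 2 * m by omega, show 2 * i + 1 < 2 * m by omega, dite_true]
    rfl
  rw [← h]
  rfl

theorem shiftAdversary_implementedBy {d m : ℕ} {ε : ℝ} (hε : 0 ≤ ε) (z : ℕ → Vec d) :
    (shiftAdversary m hε z).ImplementedBy preprocess evaluate
      (m * (9 * d + 10) + 5 * d + 6) (7 * d + 2) := by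
  intro f
  obtain ⟨s, b, hb, he, h0, h2, h3, h4⟩ := exec_preprocess (m := m) f z ε
  refine ⟨s, b, hb, he, fun x => ?_⟩
  obtain ⟨s', b', hb', he', hx⟩ := exec_evaluate f (s.withInput x) h0 h2
  refine ⟨s', b', hb', he', ?_⟩
  rw [shiftAdversary_attack]
  ext k
  have := hx k k.2
  simp only [Memory.vec, zero_add, this]
  simp [Memory.withInput, Function.update, h3, h4]


/-! ### The uniform distribution on the sphere -/

/-- `Measure.toSphere` of a set is the dimension times the volume of the cone over it in the unit
ball, so its normalization is the radial projection of the uniform law on the ball. Rotation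
invariance and the marginal bound then become statements about Lebesgue measure. -/
theorem uniformSphere_eq_map {d : ℕ} (hd : d ≠ 0) :
    uniformSphere d = (ProbabilityTheory.cond (volume : Measure (Vec d)) (Metric.ball 0 1)).map
      fun z => ‖z‖⁻¹ • z := by
  have hball : volume (Metric.ball (0 : Vec d) 1) ≠ 0 :=
    (Metric.isOpen_ball.measure_pos _ (by simp)).ne'
  have hball' : volume (Metric.ball (0 : Vec d) 1) ≠ ∞ := measure_ball_lt_top.ne
  have : Nonempty (Fin d) := ⟨⟨0, Nat.pos_of_ne_zero hd⟩⟩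
  have : Nontrivial (Vec d) := inferInstance
  ext A hA
  have hmeas : Measurable fun z : Vec d => ‖z‖⁻¹ • z := by fun_prop
  have hset : (Metric.ball 0 1 ∩ (fun z => ‖z‖⁻¹ • z) ⁻¹' A : Set (Vec d)) =ᵐ[volume]
      (Set.Ioo (0 : ℝ) 1 • ((↑) '' ((↑) ⁻¹' A : Set (Metric.sphere (0 : Vec d) 1))) :
        Set (Vec d)) := by
    have : ∀ᵐ z : Vec d ∂volume, z ≠ 0 := by
      simp [ae_iff]
    filter_upwards [this] with z hz
    have hz' := norm_pos_iff.2 hz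
    apply propext
    change (z ∈ Metric.ball (0 : Vec d) 1 ∧ ‖z‖⁻¹ • z ∈ A) ↔ _
    rw [mem_ball_zero_iff]
    constructor
    · rintro ⟨h1, h2⟩
      exact Set.mem_smul.2 ⟨‖z‖, ⟨hz', h1⟩, ‖z‖⁻¹ • z,
        ⟨⟨‖z‖⁻¹ • z, by simp [norm_smul, hz'.ne']⟩, h2, rfl⟩, by simp [smul_smul, hz'.ne']⟩
    · intro h
      obtain ⟨r, hr, _, ⟨w, hw, rfl⟩, rfl⟩ := Set.mem_smul.1 h
      have hw1 : ‖(w : Vec d)‖ = 1 := by simp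
      simp only [norm_smul, hw1, mul_one, Real.norm_of_nonneg hr.1.le, smul_smul,
        inv_mul_cancel₀ hr.1.ne', one_smul]
      exact ⟨hr.2, hw⟩
  rw [Measure.map_apply hmeas hA, ProbabilityTheory.cond_apply Metric.isOpen_ball.measurableSet,
    measure_congr hset, uniformSphere, Measure.map_apply measurable_subtype_coe hA,
    Measure.smul_apply, Measure.toSphere_apply_univ, Measure.toSphere_apply' _
      (measurable_subtype_coe hA), smul_eq_mul, finrank_euclideanSpace_fin,
    ENNReal.mul_inv (Or.inr hball') (Or.inr hball), mul_mul_mul_comm,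
    ENNReal.inv_mul_cancel (by simpa using hd) (by simp), one_mul]

theorem isProbabilityMeasure_uniformSphere {d : ℕ} (hd : d ≠ 0) :
    IsProbabilityMeasure (uniformSphere d) := by
  have : IsProbabilityMeasure
      (ProbabilityTheory.cond (volume : Measure (Vec d)) (Metric.ball 0 1)) :=
    ProbabilityTheory.cond_isProbabilityMeasure_of_finite
      (Metric.isOpen_ball.measure_pos _ (by simp)).ne' measure_ball_lt_top.ne
  rw [uniformSphere_eq_map hd]
  exact Measure.isProbabilityMeasure_map (by fun_prop)

theorem ae_norm_eq_one (d : ℕ) : ∀ᵐ x ∂uniformSphere d, ‖x‖ = 1 := by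
  rw [uniformSphere, ae_map_iff (by fun_prop) (measurableSet_eq_fun (by fun_prop) (by fun_prop))]
  exact Eventually.of_forall fun x => by simp

theorem measurePreserving_uniformSphere {d : ℕ} (hd : d ≠ 0) (L : Vec d ≃ₗᵢ[ℝ] Vec d) :
    MeasurePreserving L (uniformSphere d) (uniformSphere d) := by
  refine ⟨L.continuous.measurable, ?_⟩
  have hmeas : Measurable fun z : Vec d => ‖z‖⁻¹ • z := by fun_prop
  have hL : (ProbabilityTheory.cond (volume : Measure (Vec d)) (Metric.ball 0 1)).map L =
      ProbabilityTheory.cond (volume : Measure (Vec d)) (Metric.ball 0 1) := by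
    have h := (L.measurePreserving.restrict_preimage
      (s := Metric.ball (0 : Vec d) 1) Metric.isOpen_ball.measurableSet).map_eq
    rw [show L ⁻¹' Metric.ball (0 : Vec d) 1 = Metric.ball 0 1 by ext; simp] at h
    -- `L` preserves the uniform law on the ball, and it commutes with the radial projection.
    rw [ProbabilityTheory.cond, Measure.map_smul, h]
  rw [uniformSphere_eq_map hd, Measure.map_map L.continuous.measurable hmeas]
  conv_rhs => rw [← hL]
  rw [Measure.map_map hmeas L.continuous.measurable]
  congr 1
  ext1 z
  simp

theorem uniformSphere_pos_of_isOpen {d : ℕ} {A : Set (Vec d)} (hA : IsOpen A)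
    {x : Vec d} (hx : ‖x‖ = 1) (hxA : x ∈ A) : 0 < uniformSphere d A := by
  rw [uniformSphere, Measure.map_apply measurable_subtype_coe hA.measurableSet, Measure.smul_apply,
    smul_eq_mul]
  refine ENNReal.mul_pos (ENNReal.inv_ne_zero.2 (measure_ne_top _ _)) ?_
  exact ((hA.preimage continuous_subtype_val).measure_pos _ ⟨⟨x, by simpa using hx⟩, hxA⟩).ne'

/-! ### Marginals -/

/-- The law of the inner product with a unit vector does not depend on the vector. -/
theorem map_inner_eq {d : ℕ} {y y' : Vec d} (hy : ‖y‖ = 1) (hy' : ‖y'‖ = 1) :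
    (uniformSphere d).map (fun x => inner ℝ x y) = (uniformSphere d).map fun x => inner ℝ x y' := by
  have hd : d ≠ 0 := by
    rintro rfl
    simp [Subsingleton.elim y 0] at hy
  -- The reflection in the hyperplane orthogonal to `y - y'` takes `y` to `y'`.
  set L := (ℝ ∙ (y - y'))ᗮ.reflection
  have hL : L y = y' := Submodule.reflection_sub (hy.trans hy'.symm)
  conv_rhs => rw [← (measurePreserving_uniformSphere hd L).map_eq]
  rw [Measure.map_map (by fun_prop) L.continuous.measurable]
  congr 1
  ext1 x
  simp only [Function.comp]
  rw [← hL, LinearIsometryEquiv.inner_map_map]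

/-- Split off the first coordinate. -/
theorem exists_measurePreserving_split (n : ℕ) :
    ∃ φ : Vec (n + 1) → ℝ × Vec n, MeasurePreserving φ volume volume ∧
      ∀ z, (φ z).1 = z 0 ∧ ‖z‖ ^ 2 = z 0 ^ 2 + ‖(φ z).2‖ ^ 2 := by
  have h₁ := PiLp.volume_preserving_ofLp (Fin (n + 1))
  have h₂ := volume_preserving_piFinSuccAbove (fun _ : Fin (n + 1) => ℝ) 0
  have h₃ := (MeasurePreserving.id (volume : Measure ℝ)).prod (PiLp.volume_preserving_toLp (Fin n))
  refine ⟨_, h₃.comp (h₂.comp h₁), fun z => ⟨rfl, ?_⟩⟩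
  simp [EuclideanSpace.norm_sq_eq, Fin.sum_univ_succ, MeasurableEquiv.piFinSuccAbove,
    Fin.insertNthEquiv, Fin.tail]


/-! ### The density of the marginals near the equator -/

/-- Log-convexity of the Gamma function at the midpoint of `n/2 + 1` and `n/2 + 2` bounds `Γ((n +
3)/2)` by `√(n/2 + 1) Γ(n/2 + 1)`. -/
theorem volume_ball_le_mul_volume_ball_succ {n : ℕ} (hn : n ≠ 0) :
    volume (Metric.ball (0 : Vec n) 1) ≤
      ENNReal.ofReal (Real.sqrt (n + 1) / Real.sqrt Real.pi) *
        volume (Metric.ball (0 : Vec (n + 1)) 1) := by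
  have : Nonempty (Fin n) := ⟨⟨0, Nat.pos_of_ne_zero hn⟩⟩
  rw [EuclideanSpace.volume_ball, EuclideanSpace.volume_ball, ENNReal.ofReal_one, one_pow, one_pow,
    one_mul, one_mul, ← ENNReal.ofReal_mul (by positivity), Fintype.card_fin, Fintype.card_fin]
  refine ENNReal.ofReal_le_ofReal ?_
  have hs : (0 : ℝ) < n / 2 + 1 := by positivity
  have hΓ := Real.Gamma_mul_add_mul_le_rpow_Gamma_mul_rpow_Gamma hs
    (by positivity : (0 : ℝ) < n / 2 + 1 + 1) one_half_pos one_half_pos (add_halves 1)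
  have hpos : 0 < Real.Gamma (n / 2 + 1) := Real.Gamma_pos_of_pos hs
  rw [Real.Gamma_add_one hs.ne', ← Real.sqrt_eq_rpow, ← Real.sqrt_eq_rpow,
    Real.sqrt_mul hs.le, mul_left_comm, Real.mul_self_sqrt hpos.le,
    show 1 / 2 * ((n : ℝ) / 2 + 1) + 1 / 2 * (n / 2 + 1 + 1) = ((n + 1 : ℕ) : ℝ) / 2 + 1 by
      push_cast; ring] at hΓ
  have hpos' : 0 < Real.Gamma (((n + 1 : ℕ) : ℝ) / 2 + 1) := Real.Gamma_pos_of_pos (by positivity)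
  have hsqrt : Real.sqrt ((n : ℝ) / 2 + 1) ≤ Real.sqrt (n + 1) :=
    Real.sqrt_le_sqrt (by linarith [(Nat.cast_nonneg n : (0 : ℝ) ≤ n)])
  have hπ : 0 < Real.sqrt Real.pi := Real.sqrt_pos.2 Real.pi_pos
  rw [div_mul_div_comm, div_le_div_iff₀ hpos (by positivity), pow_succ]
  calc _ = Real.sqrt Real.pi ^ n * Real.sqrt Real.pi * Real.Gamma (((n + 1 : ℕ) : ℝ) / 2 + 1) := by
        ring
    _ ≤ Real.sqrt Real.pi ^ n * Real.sqrt Real.pi *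
        (Real.sqrt (n + 1) * Real.Gamma (n / 2 + 1)) := by
        gcongr
        exact hΓ.trans (by gcongr)
    _ = _ := by ring

/-- The function `s / √(1 - s²)` has derivative `(1 - s²)^(-3/2)`, at most `(3/4)^(-3/2) < 1.7` on
`[0, 1/2]`. It turns the height of a point on the sphere into the slope of a cone. -/
theorem div_sqrt_sub_div_sqrt_le {a b : ℝ} (ha : 0 ≤ a) (hab : a ≤ b) (hb : b ≤ 1 / 2) :
    b / Real.sqrt (1 - b ^ 2) - a / Real.sqrt (1 - a ^ 2) ≤ 17 / 10 * (b - a) := by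
  have hB0 : (0 : ℝ) ≤ 1 - b ^ 2 := by nlinarith
  have hA0 : (0 : ℝ) ≤ 1 - a ^ 2 := by nlinarith
  set A := Real.sqrt (1 - a ^ 2) with hA
  set B := Real.sqrt (1 - b ^ 2) with hB
  have hB1 : 0.86 ≤ B := Real.le_sqrt_of_sq_le (by nlinarith)
  have hBA : B ≤ A := Real.sqrt_le_sqrt (by nlinarith)
  have hAA : A ^ 2 = 1 - a ^ 2 := Real.sq_sqrt hA0
  have hBB : B ^ 2 = 1 - b ^ 2 := Real.sq_sqrt hB0
  have hApos : 0 < A := by linarith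
  have hBpos : 0 < B := by linarith
  rcases (ha.trans hab).eq_or_lt with hb0 | hb0
  · have : a = 0 := by linarith
    simp [← hb0, this]
  rw [div_sub_div _ _ hBpos.ne' hApos.ne', div_le_iff₀ (by positivity)]
  have h1 : (b * A - B * a) * (b * A + B * a) = (b - a) * (b + a) := by
    linear_combination b ^ 2 * hAA - a ^ 2 * hBB
  have h2 : (b + a) * B ≤ b * A + B * a := by nlinarith
  have h3 : 0 ≤ b * A - B * a := by nlinarith
  have h4 : (b * A - B * a) * B ≤ b - a := by
    have : (b * A - B * a) * ((b + a) * B) ≤ (b - a) * (b + a) := by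
      rw [← h1]; gcongr
    have hpos : 0 < b + a := by linarith
    nlinarith
  have h5 : 1 ≤ 17 / 10 * (B * A) * B := by
    have : 0.86 * 0.86 * 0.86 ≤ B * A * B := by gcongr; linarith
    linarith
  have h6 : (b * A - B * a) * B ≤ 17 / 10 * (b - a) * (B * A) * B := by
    nlinarith [sub_nonneg.2 hab]
  exact le_of_mul_le_mul_right h6 hBpos

/-- The marginals of the uniform distribution on the sphere have density at most `√d` on
`[0, 1/2]`. -/
theorem uniformSphere_slab_le {d : ℕ} (hd : 2 ≤ d) {y : Vec d} (hy : ‖y‖ = 1) {a b : ℝ}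
    (ha : 0 ≤ a) (hab : a ≤ b) (hb : b ≤ 1 / 2) :
    uniformSphere d {x | inner ℝ x y ∈ Set.Icc a b} ≤ ENNReal.ofReal ((b - a) * Real.sqrt d) := by
  obtain ⟨n, rfl⟩ : ∃ n, d = n + 1 := ⟨d - 1, by omega⟩
  have hn : n ≠ 0 := by omega
  set e : Vec (n + 1) := EuclideanSpace.single 0 1 with he
  have he1 : ‖e‖ = 1 := by simp [he]
  have hlaw := congrArg (fun μ => μ (Set.Icc a b)) (map_inner_eq hy he1)
  simp only [Measure.map_apply (show Measurable fun x : Vec (n + 1) => inner ℝ x y by fun_prop)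
    measurableSet_Icc, Measure.map_apply
    (show Measurable fun x : Vec (n + 1) => inner ℝ x e by fun_prop) measurableSet_Icc] at hlaw
  change uniformSphere (n + 1) ((fun x => inner ℝ x y) ⁻¹' Set.Icc a b) ≤ _
  rw [hlaw, uniformSphere_eq_map (by omega), Measure.map_apply (by fun_prop)
    (measurableSet_Icc.preimage (by fun_prop)), ProbabilityTheory.cond_apply
      Metric.isOpen_ball.measurableSet]
  have hball : volume (Metric.ball (0 : Vec (n + 1)) 1) ≠ 0 :=
    (Metric.isOpen_ball.measure_pos _ (by simp)).ne'
  have hball' : volume (Metric.ball (0 : Vec (n + 1)) 1) ≠ ∞ := measure_ball_lt_top.ne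
  obtain ⟨φ, hφ, hφz⟩ := exists_measurePreserving_split n
  set α := a / Real.sqrt (1 - a ^ 2)
  set β := b / Real.sqrt (1 - b ^ 2)
  -- The cone over the slab, in coordinates `z 0` and `r = ‖(φ z).2‖`: the condition `a ≤ z 0 / ‖z‖
  -- ≤ b` reads `α r ≤ z 0 ≤ β r`. Enlarging the ball to the cylinder `r < 1` makes every slice over
  -- the second factor an interval of length at most `β - α`.
  set T : Set (ℝ × Vec n) :=
    {p | ‖p.2‖ < 1 ∧ α * ‖p.2‖ ≤ p.1 ∧ p.1 ≤ β * ‖p.2‖} with hT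
  have hTm : MeasurableSet T := by
    exact (measurableSet_lt (f := fun p : ℝ × Vec n => ‖p.2‖) (by fun_prop)
      measurable_const).inter ((measurableSet_le (f := fun p : ℝ × Vec n => α * ‖p.2‖)
        (by fun_prop) measurable_fst).inter (measurableSet_le (g := fun p : ℝ × Vec n => β * ‖p.2‖)
        measurable_fst (by fun_prop)))
  have hαβ : β - α ≤ 17 / 10 * (b - a) := div_sqrt_sub_div_sqrt_le ha hab hb
  have hTvol : volume T ≤ ENNReal.ofReal (17 / 10 * (b - a)) * volume (Metric.ball (0 : Vec n) 1) := by
    rw [Measure.volume_eq_prod, Measure.prod_apply_symm hTm]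
    calc ∫⁻ w : Vec n, volume ((fun t => (t, w)) ⁻¹' T)
        ≤ ∫⁻ w : Vec n, (Metric.ball (0 : Vec n) 1).indicator
            (fun _ => ENNReal.ofReal (17 / 10 * (b - a))) w := by
          refine lintegral_mono fun w => ?_
          by_cases hw : ‖w‖ < 1
          · rw [Set.indicator_of_mem (by simpa using hw)]
            calc volume ((fun t => (t, w)) ⁻¹' T) ≤ volume (Set.Icc (α * ‖w‖) (β * ‖w‖)) :=
                  measure_mono fun t ht => ht.2
              _ ≤ _ := by
                  rw [Real.volume_Icc]
                  refine ENNReal.ofReal_le_ofReal ?_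
                  nlinarith [norm_nonneg w]
          · have : (fun t : ℝ => (t, w)) ⁻¹' T = ∅ := by
              ext t
              simp only [Set.mem_preimage, Set.mem_empty_iff_false, iff_false]
              exact fun h => hw h.1
            simp [this]
      _ = _ := by
          rw [lintegral_indicator Metric.isOpen_ball.measurableSet, lintegral_const,
            Measure.restrict_apply_univ]
  have hsub : volume (Metric.ball 0 1 ∩
      (fun z : Vec (n + 1) => ‖z‖⁻¹ • z) ⁻¹' ((fun x => inner ℝ x e) ⁻¹' Set.Icc a b)) ≤
      volume T := by
    rw [← hφ.measure_preimage hTm.nullMeasurableSet]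
    have h0 : ∀ᵐ z : Vec (n + 1) ∂volume, z ≠ 0 := by simp [ae_iff]
    refine measure_mono_ae ?_
    filter_upwards [h0] with z hz0 hz
    have hzb : ‖z‖ < 1 := by simpa using hz.1
    have hz2 : inner ℝ (‖z‖⁻¹ • z) e ∈ Set.Icc a b := hz.2
    obtain ⟨h1, h2⟩ := hφz z
    have hzpos : 0 < ‖z‖ := norm_pos_iff.2 hz0
    have hin : inner ℝ (‖z‖⁻¹ • z) e = z 0 / ‖z‖ := by
      simp [he, inner_smul_left, EuclideanSpace.inner_single_right, div_eq_inv_mul]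
    rw [hin, Set.mem_Icc, le_div_iff₀ hzpos, div_le_iff₀ hzpos] at hz2
    obtain ⟨h3, h4⟩ := hz2
    have hz00 : 0 ≤ z 0 := le_trans (by positivity) h3
    set r := ‖(φ z).2‖ with hr
    have hr0 : 0 ≤ r := norm_nonneg _
    have hAp : 0 < Real.sqrt (1 - a ^ 2) := Real.sqrt_pos.2 (by nlinarith)
    have hBp : 0 < Real.sqrt (1 - b ^ 2) := Real.sqrt_pos.2 (by nlinarith)
    have hAs : Real.sqrt (1 - a ^ 2) ^ 2 = 1 - a ^ 2 := Real.sq_sqrt (by nlinarith)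
    have hBs : Real.sqrt (1 - b ^ 2) ^ 2 = 1 - b ^ 2 := Real.sq_sqrt (by nlinarith)
    -- All three follow from `‖z‖² = z 0² + r²`, after squaring in the last two.
    refine ⟨?_, ?_, ?_⟩
    · change r < 1
      nlinarith
    · change α * r ≤ (φ z).1
      rw [h1, div_mul_eq_mul_div, div_le_iff₀ hAp]
      refine (sq_le_sq₀ (by positivity) (by positivity)).1 ?_
      have : (a * ‖z‖) ^ 2 ≤ z 0 ^ 2 := by gcongr
      rw [mul_pow, mul_pow, hAs]
      nlinarith
    · change (φ z).1 ≤ β * r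
      rw [h1, div_mul_eq_mul_div, le_div_iff₀ hBp]
      refine (sq_le_sq₀ (by positivity) (mul_nonneg (by linarith) hr0)).1 ?_
      have : z 0 ^ 2 ≤ (b * ‖z‖) ^ 2 := by gcongr
      rw [mul_pow, mul_pow, hBs]
      nlinarith
  calc _ ≤ (volume (Metric.ball (0 : Vec (n + 1)) 1))⁻¹ * (ENNReal.ofReal (17 / 10 * (b - a)) *
          (ENNReal.ofReal (Real.sqrt (n + 1) / Real.sqrt Real.pi) *
            volume (Metric.ball (0 : Vec (n + 1)) 1))) := by
        gcongr
        exact (hsub.trans hTvol).trans (by gcongr; exact volume_ball_le_mul_volume_ball_succ hn)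
    _ = ENNReal.ofReal (17 / 10 * (b - a)) *
          ENNReal.ofReal (Real.sqrt (n + 1) / Real.sqrt Real.pi) := by
        rw [mul_left_comm _⁻¹, mul_left_comm _⁻¹, ENNReal.inv_mul_cancel hball hball', mul_one]
    _ ≤ _ := by
        rw [← ENNReal.ofReal_mul (by linarith)]
        refine ENNReal.ofReal_le_ofReal ?_
        -- The factor `√π` from the ratio of the ball volumes absorbs the constant `17/10`.
        have hπ : 17 / 10 ≤ Real.sqrt Real.pi :=
          Real.le_sqrt_of_sq_le (by linarith [Real.pi_gt_three])
        have hπ0 : 0 < Real.sqrt Real.pi := by linarith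
        push_cast
        rw [mul_div_assoc', div_le_iff₀ hπ0]
        have : 0 ≤ (b - a) * Real.sqrt (n + 1) := mul_nonneg (by linarith) (by positivity)
        nlinarith


/-! ### Caps of the unit sphere -/

/-- The fraction of the unit sphere that lies above height `t` in direction `y`. -/
noncomputable def capFraction {d : ℕ} (y : Vec d) (t : ℝ) : ℝ :=
  (uniformSphere d).real {x | t ≤ inner ℝ x y}

theorem capFraction_nonneg {d : ℕ} (y : Vec d) (t : ℝ) : 0 ≤ capFraction y t :=
  measureReal_nonneg

theorem measurableSet_le_inner {d : ℕ} (y : Vec d) (t : ℝ) :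
    MeasurableSet {x : Vec d | t ≤ inner ℝ x y} :=
  measurableSet_le measurable_const (by fun_prop)

theorem ne_zero_of_norm_eq_one {d : ℕ} {y : Vec d} (hy : ‖y‖ = 1) : d ≠ 0 := by
  rintro rfl
  simp [Subsingleton.elim y 0] at hy

theorem uniformSphere_cap {d : ℕ} {y : Vec d} (hy : ‖y‖ = 1) (t : ℝ) :
    uniformSphere d (cap y 1 t) = ENNReal.ofReal (capFraction y t) := by
  have := isProbabilityMeasure_uniformSphere (ne_zero_of_norm_eq_one hy)
  rw [capFraction, ofReal_measureReal]
  refine measure_congr ?_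
  filter_upwards [ae_norm_eq_one d] with x hx
  exact propext ⟨fun h => h.2, fun h => ⟨by simp [hx], h⟩⟩

theorem capFraction_congr {d : ℕ} {y y' : Vec d} (hy : ‖y‖ = 1) (hy' : ‖y'‖ = 1) (t : ℝ) :
    capFraction y t = capFraction y' t := by
  have hlaw := congrArg (fun μ => μ.real (Set.Ici t)) (map_inner_eq hy hy')
  rwa [map_measureReal_apply (by fun_prop) measurableSet_Ici,
    map_measureReal_apply (by fun_prop) measurableSet_Ici] at hlaw

theorem capFraction_anti {d : ℕ} {y : Vec d} (hy : ‖y‖ = 1) {a b : ℝ} (hab : a ≤ b) :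
    capFraction y b ≤ capFraction y a := by
  have := isProbabilityMeasure_uniformSphere (ne_zero_of_norm_eq_one hy)
  exact measureReal_mono fun x (hx : b ≤ _) => hab.trans hx

theorem capFraction_sub_le {d : ℕ} (hd : 2 ≤ d) {y : Vec d} (hy : ‖y‖ = 1) {a b : ℝ}
    (ha : 0 ≤ a) (hab : a ≤ b) (hb : b ≤ 1 / 2) :
    capFraction y a - capFraction y b ≤ (b - a) * Real.sqrt d := by
  have := isProbabilityMeasure_uniformSphere (ne_zero_of_norm_eq_one hy)
  have h1 : capFraction y a ≤ capFraction y b +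
      (uniformSphere d).real {x | inner ℝ x y ∈ Set.Icc a b} := by
    refine (measureReal_mono fun x (hx : a ≤ _) => ?_).trans (measureReal_union_le _ _)
    exact (le_total b (inner ℝ x y)).imp id fun h => ⟨hx, h⟩
  have h2 : (uniformSphere d).real {x | inner ℝ x y ∈ Set.Icc a b} ≤ (b - a) * Real.sqrt d :=
    ENNReal.toReal_le_of_le_ofReal (mul_nonneg (sub_nonneg.2 hab) (Real.sqrt_nonneg _))
      (uniformSphere_slab_le hd hy ha hab hb)
  linarith

/-- The antipodal map exchanges the two closed hemispheres, and the equator is null by the slab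
bound with `a = b = 0`. -/
theorem capFraction_zero {d : ℕ} (hd : 2 ≤ d) {y : Vec d} (hy : ‖y‖ = 1) :
    capFraction y 0 = 1 / 2 := by
  have := isProbabilityMeasure_uniformSphere (ne_zero_of_norm_eq_one hy)
  have hneg : (uniformSphere d).real {x | inner ℝ x y ≤ 0} = capFraction y 0 := by
    have h := (measurePreserving_uniformSphere (by omega)
      (LinearIsometryEquiv.neg ℝ (E := Vec d))).measureReal_preimage
      (measurableSet_le_inner y 0).nullMeasurableSet
    rw [capFraction, ← h]
    congr 1
    ext x
    simp
  have hnull : uniformSphere d ({x | 0 ≤ inner ℝ x y} ∩ {x | inner ℝ x y ≤ 0}) = 0 := by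
    have h := uniformSphere_slab_le hd hy le_rfl le_rfl (by norm_num : (0 : ℝ) ≤ 1 / 2)
    simp only [sub_self, zero_mul, ENNReal.ofReal_zero, nonpos_iff_eq_zero] at h
    exact h
  have hunion := measureReal_union_add_inter (μ := uniformSphere d)
    (s := {x | 0 ≤ inner ℝ x y}) (t := {x | inner ℝ x y ≤ 0})
    (measurableSet_le (by fun_prop) measurable_const)
  have huniv : {x : Vec d | 0 ≤ inner ℝ x y} ∪ {x | inner ℝ x y ≤ 0} = Set.univ :=
    Set.eq_univ_of_forall fun x => le_total 0 (inner ℝ x y)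
  rw [huniv, probReal_univ, measureReal_def, hnull, hneg, ENNReal.toReal_zero] at hunion
  change _ = capFraction y 0 + _ at hunion
  linarith

theorem integrable_of_bound_sphere {d : ℕ} (hd : d ≠ 0) {g : Vec d → ℝ} (hg : Measurable g)
    {C : ℝ} (h : ∀ x, ‖x‖ = 1 → |g x| ≤ C) : Integrable g (uniformSphere d) := by
  have := isProbabilityMeasure_uniformSphere hd
  refine Integrable.of_bound hg.aestronglyMeasurable C ?_
  filter_upwards [ae_norm_eq_one d] with x hx using h x hx

theorem abs_inner_le_one {d : ℕ} {x y : Vec d} (hx : ‖x‖ = 1) (hy : ‖y‖ = 1) :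
    |inner ℝ x y| ≤ 1 := by
  simpa [hx, hy] using abs_real_inner_le_norm x y

/-- By rotation invariance all squared coordinates have this mean, and they sum to one. -/
theorem integral_inner_sq {d : ℕ} {y : Vec d} (hy : ‖y‖ = 1) :
    ∫ x, inner ℝ x y ^ 2 ∂uniformSphere d = 1 / d := by
  have hd := ne_zero_of_norm_eq_one hy
  have := isProbabilityMeasure_uniformSphere hd
  have hlaw : ∀ k : Fin d, ∫ x : Vec d, x k ^ 2 ∂uniformSphere d =
      ∫ x, inner ℝ x y ^ 2 ∂uniformSphere d := by
    intro k
    have he : ‖(EuclideanSpace.single k 1 : Vec d)‖ = 1 := by simp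
    have h := congrArg (fun μ => ∫ t, t ^ 2 ∂μ) (map_inner_eq he hy)
    rw [integral_map (by fun_prop) (by fun_prop), integral_map (by fun_prop) (by fun_prop)] at h
    simpa [EuclideanSpace.inner_single_right] using h
  have hsum : ∑ k : Fin d, ∫ x : Vec d, x k ^ 2 ∂uniformSphere d = 1 := by
    rw [← integral_finsetSum]
    · have : ∀ᵐ x ∂uniformSphere d, ∑ k : Fin d, x k ^ 2 = 1 := by
        filter_upwards [ae_norm_eq_one d] with x hx
        rw [← EuclideanSpace.real_norm_sq_eq, hx, one_pow]
      rw [integral_congr_ae this]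
      simp
    · intro k _
      refine integrable_of_bound_sphere hd (by fun_prop) (C := 1) fun x hx => ?_
      rw [abs_of_nonneg (sq_nonneg _), sq_le_one_iff_abs_le_one, ← hx]
      exact PiLp.norm_apply_le x k
  simp only [hlaw, Finset.sum_const, Finset.card_univ, Fintype.card_fin, nsmul_eq_mul] at hsum
  have : (d : ℝ) ≠ 0 := by exact_mod_cast hd
  field_simp
  linarith

/-- Chebyshev's inequality for the marginal, whose second moment is `1 / d`. -/
theorem mul_sq_mul_capFraction_le {d : ℕ} {y : Vec d} (hy : ‖y‖ = 1) {t : ℝ} (ht : 0 ≤ t) :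
    d * t ^ 2 * capFraction y t ≤ 1 := by
  have hd := ne_zero_of_norm_eq_one hy
  have := isProbabilityMeasure_uniformSphere hd
  have hmarkov := mul_meas_ge_le_integral_of_nonneg (μ := uniformSphere d)
    (f := fun x => inner ℝ x y ^ 2) (Eventually.of_forall fun x => sq_nonneg _)
    (integrable_of_bound_sphere hd (by fun_prop) (C := 1) fun x hx => by
      rw [abs_of_nonneg (sq_nonneg _), sq_le_one_iff_abs_le_one]
      exact abs_inner_le_one hx hy) (t ^ 2)
  rw [integral_inner_sq hy] at hmarkov
  have hle : capFraction y t ≤ (uniformSphere d).real {x | t ^ 2 ≤ inner ℝ x y ^ 2} :=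
    measureReal_mono fun x (hx : t ≤ _) => pow_le_pow_left₀ ht hx 2
  have hd' : (0 : ℝ) < d := by exact_mod_cast Nat.pos_of_ne_zero hd
  calc (d : ℝ) * t ^ 2 * capFraction y t
      ≤ d * (t ^ 2 * (uniformSphere d).real {x | t ^ 2 ≤ inner ℝ x y ^ 2}) := by
        rw [mul_assoc]; gcongr
    _ ≤ (d : ℝ) * (1 / d) := by gcongr
    _ = 1 := by field_simp

theorem capFraction_strictAnti {d : ℕ} (hd : 2 ≤ d) {y : Vec d} (hy : ‖y‖ = 1) {a b : ℝ}
    (ha : 0 ≤ a) (hab : a < b) (hb : b ≤ 1) : capFraction y b < capFraction y a := by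
  have := isProbabilityMeasure_uniformSphere (ne_zero_of_norm_eq_one hy)
  have hrank : 1 < Module.rank ℝ (Vec d) := by
    rw [← Module.finrank_eq_rank, finrank_euclideanSpace_fin]
    exact_mod_cast hd
  -- The sphere is connected for `d ≥ 2`, so some point has height strictly between `a` and `b`; the
  -- open strip around it has positive measure.
  obtain ⟨x, hx, hxy⟩ := (isPreconnected_sphere hrank (0 : Vec d) 1).intermediate_value
    (a := -y) (b := y) (by simp [hy]) (by simp [hy]) (f := fun x => inner ℝ x y)
    (by fun_prop : Continuous fun x : Vec d => inner ℝ x y).continuousOn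
    (show (a + b) / 2 ∈ Set.Icc _ _ by
      simp [hy]
      constructor <;> linarith)
  have hopen : IsOpen {x : Vec d | a < inner ℝ x y ∧ inner ℝ x y < b} :=
    by
    have hc : Continuous fun x : Vec d => inner ℝ x y := by fun_prop
    exact (isOpen_lt continuous_const hc).inter (isOpen_lt hc continuous_const)
  have hpos := uniformSphere_pos_of_isOpen hopen (by simpa using hx)
    (show x ∈ {x : Vec d | a < inner ℝ x y ∧ inner ℝ x y < b} from by
      simp only at hxy
      constructor <;> linarith)
  have hle : (uniformSphere d).real {x | a < inner ℝ x y ∧ inner ℝ x y < b} + capFraction y b ≤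
      capFraction y a := by
    rw [capFraction, ← measureReal_union _ (measurableSet_le_inner y b)]
    · refine measureReal_mono ?_
      rintro x (⟨h, -⟩ | h)
      · exact h.le
      · exact hab.le.trans h
    · rw [Set.disjoint_left]
      exact fun x h h' => h.2.not_ge h'
  have : 0 < (uniformSphere d).real {x | a < inner ℝ x y ∧ inner ℝ x y < b} :=
    ENNReal.toReal_pos hpos.ne' (measure_ne_top _ _)
  linarith

theorem isCapHeight_iff {d : ℕ} {y : Vec d} (hy : ‖y‖ = 1) {δ t : ℝ} (hδ : 0 ≤ δ) :
    IsCapHeight d δ t ↔ t ∈ Set.Icc (0 : ℝ) 1 ∧ capFraction y t = δ := by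
  refine and_congr_right fun _ => ⟨fun h => ?_, fun h y' hy' => ?_⟩
  · have := h y (by simpa using hy)
    rwa [uniformSphere_cap hy, ENNReal.ofReal_eq_ofReal_iff (capFraction_nonneg y t) hδ] at this
  · rw [uniformSphere_cap (by simpa using hy'), capFraction_congr (by simpa using hy') hy, h]

theorem existsUnique_isCapHeight {d : ℕ} (hd : 400 ≤ d) : ∃! t, IsCapHeight d 0.01 t := by
  have hy : ‖(EuclideanSpace.single ⟨0, by omega⟩ 1 : Vec d)‖ = 1 := by simp
  set y : Vec d := EuclideanSpace.single ⟨0, by omega⟩ 1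
  simp only [isCapHeight_iff hy (by norm_num : (0 : ℝ) ≤ 0.01)]
  -- Chebyshev gives `4 / d`, whence the bound `400` on the dimension.
  have hhalf : capFraction y (1 / 2) ≤ 0.01 := by
    have h := mul_sq_mul_capFraction_le hy (by norm_num : (0 : ℝ) ≤ 1 / 2)
    have hd' : (400 : ℝ) ≤ d := by exact_mod_cast hd
    have h0 : 0 ≤ capFraction y (1 / 2) := measureReal_nonneg
    nlinarith
  have hcont : ContinuousOn (capFraction y) (Set.Icc 0 (1 / 2)) := by
    refine (LipschitzOnWith.of_le_add_mul (K := ⟨Real.sqrt d, Real.sqrt_nonneg _⟩)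
      fun a ha b hb => ?_).continuousOn
    rcases le_total a b with hab | hab
    · have := capFraction_sub_le (by omega) hy ha.1 hab hb.2
      rw [Real.dist_eq, abs_sub_comm, abs_of_nonneg (sub_nonneg.2 hab)]
      change _ ≤ _ + Real.sqrt d * _
      linarith
    · have := capFraction_anti hy hab
      have : 0 ≤ Real.sqrt d * dist a b := by positivity
      change _ ≤ _ + Real.sqrt d * _
      linarith
  obtain ⟨t, ht, htδ⟩ := intermediate_value_Icc' (by norm_num) hcont
    (show (0.01 : ℝ) ∈ Set.Icc _ _ from ⟨hhalf, by
      rw [capFraction_zero (by omega) hy]; norm_num⟩)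
  refine ⟨t, ⟨⟨ht.1, by linarith [ht.2]⟩, htδ⟩, ?_⟩
  rintro s ⟨hs, hsδ⟩
  rcases lt_trichotomy s t with h | h | h
  · have := capFraction_strictAnti (by omega) hy hs.1 h (by linarith [ht.2])
    linarith
  · exact h
  · have := capFraction_strictAnti (by omega) hy ht.1 h hs.2
    linarith

theorem IsCapHeight.bounds {d : ℕ} (hd : 400 ≤ d) {t : ℝ} (ht : IsCapHeight d 0.01 t) :
    0.49 ≤ t * Real.sqrt d ∧ t * Real.sqrt d ≤ 10 ∧ t ≤ 1 / 2 := by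
  have hy : ‖(EuclideanSpace.single ⟨0, by omega⟩ 1 : Vec d)‖ = 1 := by simp
  set y : Vec d := EuclideanSpace.single ⟨0, by omega⟩ 1
  obtain ⟨ht01, htδ⟩ := (isCapHeight_iff hy (by norm_num)).1 ht
  have hd' : (400 : ℝ) ≤ d := by exact_mod_cast hd
  have hs : (20 : ℝ) ≤ Real.sqrt d := Real.le_sqrt_of_sq_le (by linarith)
  have hss : Real.sqrt d ^ 2 = d := Real.sq_sqrt (by positivity)
  have hupper : t * Real.sqrt d ≤ 10 := by
    have h := mul_sq_mul_capFraction_le hy ht01.1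
    rw [htδ] at h
    refine le_of_abs_le (abs_le_of_sq_le_sq ?_ (by norm_num))
    rw [mul_pow, hss]
    linarith
  have hhalf : t ≤ 1 / 2 := by nlinarith [ht01.1]
  refine ⟨?_, hupper, hhalf⟩
  -- The fraction falls from `1/2` to `0.01` between heights `0` and `t`, at rate at most `√d`;
  -- hence the lower bound `0.49`.
  have h := capFraction_sub_le (by omega) hy le_rfl ht01.1 hhalf
  rw [htδ, capFraction_zero (by omega) hy] at h
  linarith


/-! ### Sums over independent samples -/

theorem memLp_sum_pi {α : Type*} [MeasurableSpace α] {μ : Measure α} [IsProbabilityMeasure μ]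
    {g : α → ℝ} (hg : MemLp g 2 μ) (m : ℕ) :
    MemLp (∑ i : Fin m, fun x : Fin m → α => g (x i)) 2 (Measure.pi fun _ => μ) :=
  memLp_finsetSum' _ fun i _ =>
    hg.comp_measurePreserving (measurePreserving_eval (fun _ : Fin m => μ) i)

/-- Variances of independent variables add, and centred variables have variance equal to their
second moment. -/
theorem integral_sq_sum_pi {α : Type*} [MeasurableSpace α] {μ : Measure α}
    [IsProbabilityMeasure μ] {g : α → ℝ} (hg : MemLp g 2 μ) (h0 : ∫ a, g a ∂μ = 0) (m : ℕ) :
    Integrable (fun x : Fin m → α => (∑ i, g (x i)) ^ 2) (Measure.pi fun _ => μ) ∧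
      ∫ x : Fin m → α, (∑ i, g (x i)) ^ 2 ∂(Measure.pi fun _ => μ) = m * ∫ a, g a ^ 2 ∂μ := by
  have hL := memLp_sum_pi hg m
  have hmean : ∫ x, (∑ i : Fin m, fun x : Fin m → α => g (x i)) x ∂(Measure.pi fun _ => μ) = 0 := by
    simp only [Finset.sum_apply]
    rw [integral_finsetSum]
    · refine Finset.sum_eq_zero fun i _ => ?_
      rw [← h0]
      exact (integral_comp_eval (μ := fun _ : Fin m => μ) (i := i) hg.aestronglyMeasurable)
    · exact fun i _ => (hg.comp_measurePreserving
        (measurePreserving_eval (fun _ : Fin m => μ) i)).integrable one_le_two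
  have hvar := ProbabilityTheory.variance_sum_pi (μ := fun _ : Fin m => μ) (X := fun _ => g)
    fun _ => hg
  rw [ProbabilityTheory.variance_of_integral_eq_zero hL.aemeasurable hmean,
    ProbabilityTheory.variance_of_integral_eq_zero hg.aemeasurable h0] at hvar
  simp only [Finset.sum_apply, Finset.sum_const, Finset.card_univ, Fintype.card_fin,
    nsmul_eq_mul] at hvar
  refine ⟨?_, hvar⟩
  simpa using hL.integrable_sq

theorem measureReal_ge_le_div {α : Type*} [MeasurableSpace α] {μ : Measure α} {f : α → ℝ}
    (h0 : ∀ a, 0 ≤ f a) (hf : Integrable f μ) {c ε : ℝ} (hε : 0 < ε) (hc : ∫ a, f a ∂μ ≤ c) :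
    μ.real {a | ε ≤ f a} ≤ c / ε := by
  rw [le_div_iff₀' hε]
  exact (mul_meas_ge_le_integral_of_nonneg (Eventually.of_forall h0) hf ε).trans hc

/-! ### Random points and a fixed direction -/

/-- The sum of those of the given points that lie above height `t` in direction `y`. -/
noncomputable def sampleSum {d m : ℕ} (t : ℝ) (x : Fin m → Vec d) (y : Vec d) : Vec d :=
  ∑ i, if t ≤ inner ℝ (x i) y then x i else 0

/-- The vector `S` points nearly in direction `y`. -/
def IsAligned {d : ℕ} (η : ℝ) (S y : Vec d) : Prop :=
  0 < inner ℝ S y ∧ ‖S‖ ^ 2 ≤ (1 + η) * inner ℝ S y ^ 2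

theorem norm_sub_inner_smul_sq {d : ℕ} (S : Vec d) {y : Vec d} (hy : ‖y‖ = 1) :
    ‖S - inner ℝ S y • y‖ ^ 2 = ‖S‖ ^ 2 - inner ℝ S y ^ 2 := by
  rw [norm_sub_sq_real, norm_smul, hy, inner_smul_right, Real.norm_eq_abs, mul_one, sq_abs]
  ring

/-- The component orthogonal to `y`, cut off below height `t`. -/
noncomputable def orthPart {d : ℕ} (t : ℝ) (y x : Vec d) : Vec d :=
  if t ≤ inner ℝ x y then x - inner ℝ x y • y else 0

theorem sum_orthPart {d m : ℕ} (t : ℝ) (y : Vec d) (x : Fin m → Vec d) :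
    ∑ i, orthPart t y (x i) = sampleSum t x y - inner ℝ (sampleSum t x y) y • y := by
  rw [sampleSum, sum_inner, Finset.sum_smul, ← Finset.sum_sub_distrib]
  refine Finset.sum_congr rfl fun i _ => ?_
  rw [orthPart]
  split_ifs <;> simp

theorem measurable_orthPart {d : ℕ} (t : ℝ) (y : Vec d) : Measurable (orthPart t y) :=
  Measurable.ite (measurableSet_le_inner y t) (by fun_prop) measurable_const

theorem norm_orthPart_sq_le {d : ℕ} (t : ℝ) {x y : Vec d} (hx : ‖x‖ = 1) (hy : ‖y‖ = 1) :
    ‖orthPart t y x‖ ^ 2 ≤ {x | t ≤ inner ℝ x y}.indicator 1 x := by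
  by_cases h : t ≤ inner ℝ x y
  · rw [orthPart, if_pos h, norm_sub_inner_smul_sq x hy, hx, Set.indicator_of_mem (by exact h)]
    simpa using sq_nonneg (inner ℝ x y)
  · rw [orthPart, if_neg h, Set.indicator_of_notMem (by exact h)]
    simp

/-! ### Second moments of the sample sum along and across the normal -/

/-- The reflection in the line through `y` keeps `⟨x, y⟩`, hence the cap, and negates the orthogonal
part. -/
theorem integral_orthPart_apply {d : ℕ} (t : ℝ) {y : Vec d} (hy : ‖y‖ = 1) (k : Fin d) :
    ∫ x, orthPart t y x k ∂uniformSphere d = 0 := by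
  have hL : ∀ x, orthPart t y ((ℝ ∙ y).reflection x) = -orthPart t y x := by
    intro x
    have h1 : (ℝ ∙ y).reflection x = (2 * inner ℝ x y) • y - x := by
      rw [Submodule.reflection_singleton_apply, hy, real_inner_comm]
      simp [two_smul, two_mul, add_smul]
    have h2 : inner ℝ ((ℝ ∙ y).reflection x) y = inner ℝ x y := by
      rw [h1, inner_sub_left, inner_smul_left, real_inner_self_eq_norm_sq, hy]
      simp
      ring
    simp only [orthPart, h2]
    split_ifs
    · rw [h1]
      module
    · simp
  have h := (measurePreserving_uniformSphere (ne_zero_of_norm_eq_one hy)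
    (ℝ ∙ y).reflection).integral_comp
      (ℝ ∙ y).reflection.toHomeomorph.measurableEmbedding (fun x => orthPart t y x k)
  simp only [hL, PiLp.neg_apply, integral_neg] at h
  linarith

variable {d m : ℕ} {t : ℝ} {y : Vec d}

theorem memLp_orthPart_apply (t : ℝ) (hy : ‖y‖ = 1) (k : Fin d) :
    MemLp (fun x => orthPart t y x k) 2 (uniformSphere d) := by
  have := isProbabilityMeasure_uniformSphere (ne_zero_of_norm_eq_one hy)
  have hm : Measurable fun x => orthPart t y x k :=
    (by fun_prop : Measurable fun v : Vec d => v k).comp (measurable_orthPart t y)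
  refine MemLp.of_bound hm.aestronglyMeasurable 1 ?_
  filter_upwards [ae_norm_eq_one d] with x hx
  refine (PiLp.norm_apply_le _ k).trans ?_
  rw [← abs_norm, ← sq_le_one_iff_abs_le_one]
  refine (norm_orthPart_sq_le t hx hy).trans ?_
  exact Set.indicator_le_self' (fun _ _ => zero_le_one) x

/-- Second moments add coordinate by coordinate. A single orthogonal part has norm at most one and
vanishes off the cap, so its mean square is at most the cap fraction. -/
theorem integral_norm_sum_orthPart_sq (t : ℝ) (hy : ‖y‖ = 1) (m : ℕ) :
    Integrable (fun x : Fin m → Vec d => ‖∑ i, orthPart t y (x i)‖ ^ 2)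
        (Measure.pi fun _ => uniformSphere d) ∧
      ∫ x : Fin m → Vec d, ‖∑ i, orthPart t y (x i)‖ ^ 2 ∂(Measure.pi fun _ => uniformSphere d) ≤
        m * capFraction y t := by
  have hd := ne_zero_of_norm_eq_one hy
  have := isProbabilityMeasure_uniformSphere hd
  have hk := fun k => integral_sq_sum_pi (memLp_orthPart_apply t hy k)
    (integral_orthPart_apply t hy k) m
  have hexp : (fun x : Fin m → Vec d => ‖∑ i, orthPart t y (x i)‖ ^ 2) =
      fun x => ∑ k, (∑ i, orthPart t y (x i) k) ^ 2 := by
    ext x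
    simp [EuclideanSpace.real_norm_sq_eq]
  rw [hexp]
  refine ⟨integrable_finsetSum _ fun k _ => (hk k).1, ?_⟩
  rw [integral_finsetSum _ fun k _ => (hk k).1]
  simp only [(hk _).2, ← Finset.mul_sum]
  rw [← integral_finsetSum _ fun k _ => (memLp_orthPart_apply t hy k).integrable_sq]
  refine mul_le_mul_of_nonneg_left ?_ (Nat.cast_nonneg m)
  rw [capFraction, ← integral_indicator_one (measurableSet_le_inner y t)]
  refine integral_mono_ae (integrable_finsetSum _ fun k _ =>
    (memLp_orthPart_apply t hy k).integrable_sq)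
    ((integrable_const (1 : ℝ)).indicator (measurableSet_le_inner y t)) ?_
  filter_upwards [ae_norm_eq_one d] with x hx
  have := norm_orthPart_sq_le t hx hy
  rwa [EuclideanSpace.real_norm_sq_eq] at this

theorem integral_sq_count (t : ℝ) (hy : ‖y‖ = 1) (m : ℕ) :
    Integrable (fun x : Fin m → Vec d =>
        (∑ i, ({x | t ≤ inner ℝ x y}.indicator 1 (x i) - capFraction y t)) ^ 2)
        (Measure.pi fun _ => uniformSphere d) ∧
      ∫ x : Fin m → Vec d, (∑ i, ({x | t ≤ inner ℝ x y}.indicator 1 (x i) - capFraction y t)) ^ 2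
        ∂(Measure.pi fun _ => uniformSphere d) ≤ m * capFraction y t := by
  have := isProbabilityMeasure_uniformSphere (ne_zero_of_norm_eq_one hy)
  have hA := measurableSet_le_inner y t
  have hI : MemLp ({x | t ≤ inner ℝ x y}.indicator (1 : Vec d → ℝ)) 2 (uniformSphere d) :=
    memLp_indicator_const 2 hA (1 : ℝ) (Or.inr (measure_ne_top _ _))
  have hint : ∫ x, {x | t ≤ inner ℝ x y}.indicator (1 : Vec d → ℝ) x ∂uniformSphere d =
    capFraction y t := integral_indicator_one hA
  have hg : MemLp (fun x => {x | t ≤ inner ℝ x y}.indicator (1 : Vec d → ℝ) x - capFraction y t) 2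
    (uniformSphere d) := hI.sub (memLp_const _)
  have h0 : ∫ x, ({x | t ≤ inner ℝ x y}.indicator (1 : Vec d → ℝ) x - capFraction y t)
      ∂uniformSphere d = 0 := by
    rw [integral_sub (hI.integrable one_le_two) (integrable_const _), hint]
    simp
  obtain ⟨h1, h2⟩ := integral_sq_sum_pi hg h0 m
  refine ⟨h1, h2.trans_le (mul_le_mul_of_nonneg_left ?_ (Nat.cast_nonneg m))⟩
  rw [← ProbabilityTheory.variance_of_integral_eq_zero hg.aemeasurable h0,
    ProbabilityTheory.variance_sub_const hI.aestronglyMeasurable]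
  refine (ProbabilityTheory.variance_le_expectation_sq hI.aestronglyMeasurable).trans_eq ?_
  rw [← hint]
  refine integral_congr_ae (Eventually.of_forall fun x => ?_)
  simp only [Pi.pow_apply]
  by_cases h : t ≤ inner ℝ x y
  · simp [Set.indicator, h]
  · simp [Set.indicator, h]

theorem mul_count_le_inner_sampleSum (x : Fin m → Vec d) :
    t * ∑ i, {x | t ≤ inner ℝ x y}.indicator (1 : Vec d → ℝ) (x i) ≤
      inner ℝ (sampleSum t x y) y := by
  rw [sampleSum, sum_inner, Finset.mul_sum]
  refine Finset.sum_le_sum fun i _ => ?_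
  by_cases h : t ≤ inner ℝ (x i) y
  · simp [Set.indicator, h]
  · simp [Set.indicator, h]

/-- Two events of probability at most `0.005` are excluded: an orthogonal part of squared norm at
least `2 m`, by Markov, and a count off its mean `0.01 m` by at least `0.005 m`, by Chebyshev. The
second has probability at most `400 / m`, which explains `80000`. -/
theorem measure_not_isAligned_le (hy : ‖y‖ = 1) (ht : 0 < t) (hδ : capFraction y t = 0.01)
    (hm : 80000 ≤ m) {η : ℝ} (hη : 2 * m ≤ η * (t * (0.005 * m)) ^ 2) :
    (Measure.pi fun _ : Fin m => uniformSphere d) {x | ¬ IsAligned η (sampleSum t x y) y} ≤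
      ENNReal.ofReal 0.01 := by
  have := isProbabilityMeasure_uniformSphere (ne_zero_of_norm_eq_one hy)
  have hm' : (80000 : ℝ) ≤ m := by exact_mod_cast hm
  obtain ⟨i1, b1⟩ := integral_norm_sum_orthPart_sq t hy m
  obtain ⟨i2, b2⟩ := integral_sq_count t hy m
  rw [hδ] at b1 i2 b2
  have p1 := measureReal_ge_le_div (fun x => by positivity) i1 (ε := 2 * m) (by linarith) b1
  have p2 := measureReal_ge_le_div (fun x => by positivity) i2 (ε := (0.005 * m) ^ 2)
    (by positivity) b2
  have e1 : (m : ℝ) * 0.01 / (2 * m) = 0.005 := by field_simp; norm_num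
  have e2 : (m : ℝ) * 0.01 / (0.005 * m) ^ 2 ≤ 0.005 := by
    rw [div_le_iff₀ (by positivity)]
    nlinarith
  rw [ENNReal.le_ofReal_iff_toReal_le (measure_ne_top _ _) (by norm_num)]
  have hunion := (measureReal_union_le _ _).trans (add_le_add (p1.trans_eq e1) (p2.trans e2))
  refine (measureReal_mono (fun x hx => ?_)).trans (hunion.trans (by norm_num))
  by_contra hcon
  rw [Set.mem_union, not_or] at hcon
  have h1 : ‖∑ i, orthPart t y (x i)‖ ^ 2 < 2 * m := lt_of_not_ge hcon.1
  have h2 : (∑ i, ({x | t ≤ inner ℝ x y}.indicator (1 : Vec d → ℝ) (x i) - 0.01)) ^ 2 <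
    (0.005 * m) ^ 2 := lt_of_not_ge hcon.2
  refine hx ?_
  rw [sum_orthPart, norm_sub_inner_smul_sq _ hy] at h1
  rw [Finset.sum_sub_distrib, Finset.sum_const, Finset.card_univ, Fintype.card_fin,
    nsmul_eq_mul] at h2
  have h3 := (abs_lt.1 (sq_lt_sq₀ (abs_nonneg _) (by positivity) |>.1 ((sq_abs _).trans_lt h2))).1
  have h4 : t * (0.005 * m) < inner ℝ (sampleSum t x y) y := by
    refine lt_of_lt_of_le ?_ (mul_count_le_inner_sampleSum x)
    gcongr
    linarith
  have h5 : 0 < t * (0.005 * m) := by positivity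
  have hη0 : 0 ≤ η := by
    by_contra hneg
    nlinarith [sq_nonneg (t * (0.005 * m))]
  refine ⟨h5.trans h4, ?_⟩
  have h6 : η * (t * (0.005 * m)) ^ 2 ≤ η * inner ℝ (sampleSum t x y) y ^ 2 := by gcongr
  linarith

theorem measurableSet_isAligned (d m : ℕ) (η t : ℝ) :
    MeasurableSet {p : (Fin m → Vec d) × Vec d | ¬ IsAligned η (sampleSum t p.1 p.2) p.2} := by
  have hS : Measurable fun p : (Fin m → Vec d) × Vec d => sampleSum t p.1 p.2 := by
    refine Finset.measurable_sum _ fun i _ => Measurable.ite ?_ (by fun_prop) measurable_const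
    exact measurableSet_le (f := fun _ : (Fin m → Vec d) × Vec d => t)
      (g := fun p => inner ℝ (p.1 i) p.2) measurable_const (by fun_prop)
  have hI : Measurable fun p : (Fin m → Vec d) × Vec d => inner ℝ (sampleSum t p.1 p.2) p.2 :=
    hS.inner measurable_snd
  exact ((measurableSet_lt measurable_const hI).inter
    (measurableSet_le (hS.norm.pow_const 2) ((hI.pow_const 2).const_mul _))).compl

/-- Some choice of the sample points works for all but a small fraction of the directions. -/
theorem exists_sample (hd : 400 ≤ d) (ht : IsCapHeight d 0.01 t) (hm : 80000 ≤ m) {η : ℝ}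
    (hη : 2 * m ≤ η * (t * (0.005 * m)) ^ 2) :
    ∃ x : Fin m → Vec d, (∀ i, ‖x i‖ = 1) ∧
      uniformSphere d {y | ¬ IsAligned η (sampleSum t x y) y} ≤ ENNReal.ofReal 0.01 := by
  have hd0 : d ≠ 0 := by omega
  have := isProbabilityMeasure_uniformSphere hd0
  set P : Measure (Fin m → Vec d) := Measure.pi fun _ => uniformSphere d with hP
  have ht0 : 0 < t := by
    by_contra hneg
    nlinarith [ht.bounds hd, Real.sqrt_nonneg d]
  have hB := measurableSet_isAligned d m η t
  have hint : ∫⁻ x, uniformSphere d {y | ¬ IsAligned η (sampleSum t x y) y} ∂P ≤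
      ENNReal.ofReal 0.01 := by
    calc _ = (P.prod (uniformSphere d)) {p | ¬ IsAligned η (sampleSum t p.1 p.2) p.2} :=
          (Measure.prod_apply hB).symm
      _ = ∫⁻ y, P {x | ¬ IsAligned η (sampleSum t x y) y} ∂uniformSphere d :=
          Measure.prod_apply_symm hB
      _ ≤ ∫⁻ _, ENNReal.ofReal 0.01 ∂uniformSphere d := by
          refine lintegral_mono_ae ?_
          filter_upwards [ae_norm_eq_one d] with y hy
          exact measure_not_isAligned_le hy ht0 ((isCapHeight_iff hy (by norm_num)).1 ht).2 hm hη
      _ = _ := by simp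
  -- The samples whose set of bad directions is at most average have positive measure, so one of
  -- them also lies on the sphere.
  have hpos := measure_le_lintegral_pos (μ := P) (measurable_measure_prodMk_left (ν := uniformSphere d) hB).aemeasurable
  have hnorm : ∀ᵐ x ∂P, ∀ i, ‖x i‖ = 1 :=
    ae_all_iff.2 fun i =>
      (measurePreserving_eval (fun _ : Fin m => uniformSphere d) i).quasiMeasurePreserving.ae
        (ae_norm_eq_one d)
  obtain ⟨x, hx, hx'⟩ := ((frequently_ae_iff.2 hpos.ne').and_eventually hnorm).exists
  exact ⟨x, hx', hx.trans hint⟩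


/-! ### The data distribution and the error set -/

theorem prod_uniformSign_apply {d : ℕ} (hd : d ≠ 0) {A : Set (Vec d × ℤˣ)} (hA : MeasurableSet A) :
    (uniformSphere d).prod uniformSign A =
      1 / 2 * uniformSphere d {x | (x, -1) ∈ A} + 1 / 2 * uniformSphere d {x | (x, 1) ∈ A} := by
  have := isProbabilityMeasure_uniformSphere hd
  rw [uniformSign, Measure.prod_add, Measure.prod_smul_right, Measure.prod_smul_right,
    Measure.prod_dirac, Measure.prod_dirac, Measure.add_apply, Measure.smul_apply,
    Measure.smul_apply, Measure.map_apply (by fun_prop) hA, Measure.map_apply (by fun_prop) hA]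
  rfl

theorem measurableSet_sign_neg_one : MeasurableSet ({-1} : Set ℤˣ) :=
  ⟨{-1}, measurableSet_singleton _, by
    ext b
    exact ⟨fun h => Units.ext h, fun h => congrArg Units.val h⟩⟩

theorem measurable_spheresData_map (d : ℕ) :
    Measurable fun z : Vec d × ℤˣ => if z.2 = -1 then z.1 else (1.3 : ℝ) • z.1 :=
  Measurable.ite (measurable_snd measurableSet_sign_neg_one) (by fun_prop) (by fun_prop)

theorem spheresData_real_apply {d : ℕ} (hd : d ≠ 0) {A : Set (Vec d)} (hA : MeasurableSet A) :
    (spheresData d).real A = 1 / 2 * (uniformSphere d).real A +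
      1 / 2 * (uniformSphere d).real {x | (1.3 : ℝ) • x ∈ A} := by
  have := isProbabilityMeasure_uniformSphere hd
  have hm := measurable_spheresData_map d
  rw [measureReal_def, spheresData, Measure.map_apply hm hA, prod_uniformSign_apply hd (hm hA),
    ENNReal.toReal_add (ENNReal.mul_ne_top (by simp) (measure_ne_top _ _))
      (ENNReal.mul_ne_top (by simp) (measure_ne_top _ _))]
  simp [measureReal_def]

theorem uniformSign_univ : uniformSign Set.univ = 1 := by
  simp [uniformSign, ENNReal.inv_two_add_inv_two]

theorem classifierOf_of_mem {d : ℕ} {h : Vec d → ℤˣ} {E : Set (Vec d)} {x : Vec d} (hx : x ∈ E) :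
    classifierOf h E x = -h x := by
  simp [classifierOf, hx]

theorem classifierOf_of_notMem {d : ℕ} {h : Vec d → ℤˣ} {E : Set (Vec d)} {x : Vec d}
    (hx : x ∉ E) : classifierOf h E x = h x := by
  simp [classifierOf, hx]

theorem classifierOf_ne_iff {d : ℕ} {h : Vec d → ℤˣ} {E : Set (Vec d)} {x : Vec d} :
    classifierOf h E x ≠ h x ↔ x ∈ E := by
  by_cases hx : x ∈ E
  · simp only [classifierOf_of_mem hx, hx, iff_true]
    rcases Int.units_eq_one_or (h x) with h | h <;> simp [h]
  · simp [classifierOf_of_notMem hx, hx]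

theorem mem_capSet_neg_one {d : ℕ} {t : ℝ} {x y : Vec d} :
    x ∈ capSet t (y, -1) ↔ (‖x‖ ≤ 1.15 ∧ t ≤ inner ℝ x y) ∧ 1.15 / 1.3 < ‖x‖ := by
  simp [capSet, cap]

theorem mem_capSet_one {d : ℕ} {t : ℝ} {x y : Vec d} :
    x ∈ capSet t (y, 1) ↔ (‖x‖ ≤ 1.495 ∧ 1.3 * t ≤ inner ℝ x y) ∧ 1.15 < ‖x‖ := by
  simp [capSet, cap]

theorem spheresTruth_of_le {d : ℕ} {x : Vec d} (hx : ‖x‖ ≤ 1.15) : spheresTruth d x = -1 :=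
  if_pos hx

theorem spheresTruth_of_lt {d : ℕ} {x : Vec d} (hx : 1.15 < ‖x‖) : spheresTruth d x = 1 :=
  if_neg hx.not_ge

/-- A shift of a point of one of the two spheres by less than `1/10` does not change its class. -/
theorem spheresTruth_add {d : ℕ} {x v : Vec d} (hx : ‖x‖ = 1 ∨ ‖x‖ = 1.3) (hv : ‖v‖ ≤ 1 / 10) :
    spheresTruth d (x + v) = spheresTruth d x := by
  have h1 := norm_add_le x v
  have h2 := norm_sub_le_norm_add x v
  rcases hx with hx | hx
  · rw [spheresTruth_of_le (x := x) (by rw [hx]; norm_num), spheresTruth_of_le (by linarith)]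
  · rw [spheresTruth_of_lt (x := x) (by rw [hx]; norm_num), spheresTruth_of_lt (by linarith)]

theorem norm_smul_of_norm_eq_one {d : ℕ} {x : Vec d} (hx : ‖x‖ = 1) : ‖(1.3 : ℝ) • x‖ = 1.3 := by
  rw [norm_smul, hx, Real.norm_of_nonneg (by norm_num), mul_one]

/-- A cap with `b = -1` meets only the inner of the two spheres, at height `t`, and one with `b = 1`
only the outer, at height `1.3 t`. Either way the pair is answered wrongly exactly when `x` is above
height `t`, so `b` need not be known. -/
theorem query_answers_iff {d : ℕ} {t : ℝ} {x y : Vec d} (hx : ‖x‖ = 1) (b : ℤˣ) :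
    (classifierOf (spheresTruth d) (capSet t (y, b)) x ≠ 1 ∧
      classifierOf (spheresTruth d) (capSet t (y, b)) ((1.3 : ℝ) • x) = 1) ↔
      ¬ t ≤ inner ℝ x y := by
  have hx' := norm_smul_of_norm_eq_one hx
  have h1 : spheresTruth d x = -1 := spheresTruth_of_le (by rw [hx]; norm_num)
  have h2 : spheresTruth d ((1.3 : ℝ) • x) = 1 := spheresTruth_of_lt (by rw [hx']; norm_num)
  have hin : inner ℝ ((1.3 : ℝ) • x) y = 1.3 * inner ℝ x y := by simp [inner_smul_left]
  rcases Int.units_eq_one_or b with rfl | rfl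
  · have e1 : x ∉ capSet t (y, 1) := fun h => by
      have := (mem_capSet_one.1 h).2
      rw [hx] at this
      norm_num at this
    have e2 : (1.3 : ℝ) • x ∈ capSet t (y, 1) ↔ t ≤ inner ℝ x y := by
      rw [mem_capSet_one, hx', hin, mul_le_mul_iff_right₀ (by norm_num)]
      norm_num
    rw [classifierOf_of_notMem e1, h1, ← e2]
    by_cases h : (1.3 : ℝ) • x ∈ capSet t (y, 1)
    · simp [classifierOf_of_mem h, h2, h]
    · simp [classifierOf_of_notMem h, h2, h]
  · have e1 : (1.3 : ℝ) • x ∉ capSet t (y, -1) := fun h => by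
      have := (mem_capSet_neg_one.1 h).1.1
      rw [hx'] at this
      norm_num at this
    have e2 : x ∈ capSet t (y, -1) ↔ t ≤ inner ℝ x y := by
      rw [mem_capSet_neg_one, hx]
      norm_num
    rw [classifierOf_of_notMem e1, h2, ← e2]
    by_cases h : x ∈ capSet t (y, -1)
    · simp [classifierOf_of_mem h, h1, h]
    · simp [classifierOf_of_notMem h, h1, h]

/-! ### The risks -/

/-- The radius of the sphere whose data points are endangered by a cap with sign `b`. -/
noncomputable def sphereRadius (b : ℤˣ) : ℝ := if b = -1 then 1 else 1.3

theorem sphereRadius_eq (b : ℤˣ) : sphereRadius b = 1 ∨ sphereRadius b = 1.3 := by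
  unfold sphereRadius
  split_ifs <;> simp

theorem ae_spheresData {d : ℕ} (hd : d ≠ 0) : ∀ᵐ x ∂spheresData d, ‖x‖ = 1 ∨ ‖x‖ = 1.3 := by
  have := isProbabilityMeasure_uniformSphere hd
  have hm := measurable_spheresData_map d
  have hA : MeasurableSet {x : Vec d | ‖x‖ = 1 ∨ ‖x‖ = 1.3} :=
    (measurableSet_eq_fun measurable_norm measurable_const).union
      (measurableSet_eq_fun measurable_norm measurable_const)
  rw [spheresData, ae_map_iff hm.aemeasurable hA, ae_iff]
  have h1 : uniformSphere d {x | ¬ ‖x‖ = 1} = 0 := ae_iff.1 (ae_norm_eq_one d)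
  refine measure_mono_null (t := {x | ¬ ‖x‖ = 1} ×ˢ Set.univ) ?_ (by
    rw [uniformSign, Measure.prod_add, Measure.prod_smul_right, Measure.prod_smul_right]
    simp [Measure.prod_prod, h1])
  rintro ⟨x, b⟩ hz
  refine ⟨fun hx => hz ?_, trivial⟩
  change ‖if b = -1 then x else (1.3 : ℝ) • x‖ = 1 ∨ ‖if b = -1 then x else (1.3 : ℝ) • x‖ = 1.3
  split_ifs
  · exact Or.inl hx
  · exact Or.inr (norm_smul_of_norm_eq_one hx)

theorem measurableSet_scaledCap {d : ℕ} (y : Vec d) (R s : ℝ) :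
    MeasurableSet {x : Vec d | ‖x‖ = R ∧ R * s ≤ inner ℝ x y} :=
  (measurableSet_eq_fun measurable_norm measurable_const).inter (measurableSet_le_inner y _)

/-- Scaling by the radius turns height `R s` on the sphere of radius `R` into height `s` on the unit
sphere; the other sphere contributes nothing, and each sphere carries half of the data. -/
theorem spheresData_scaledCap {d : ℕ} {y : Vec d} (hy : ‖y‖ = 1) (s : ℝ) (b : ℤˣ) :
    (spheresData d).real {x | ‖x‖ = sphereRadius b ∧ sphereRadius b * s ≤ inner ℝ x y} =
      1 / 2 * capFraction y s := by
  have hd := ne_zero_of_norm_eq_one hy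
  have := isProbabilityMeasure_uniformSphere hd
  rw [spheresData_real_apply hd (measurableSet_scaledCap y _ s), ← mul_add]
  congr 1
  have hin : ∀ x : Vec d, inner ℝ ((1.3 : ℝ) • x) y = 1.3 * inner ℝ x y := fun x => by
    simp [inner_smul_left]
  have hzero : ∀ A : Set (Vec d), (∀ x, ‖x‖ = 1 → x ∉ A) → (uniformSphere d).real A = 0 := by
    intro A hA
    rw [measureReal_eq_zero_iff, measure_eq_zero_iff_ae_notMem]
    filter_upwards [ae_norm_eq_one d] with x hx using hA x hx
  have hcap : ∀ A : Set (Vec d), (∀ x, ‖x‖ = 1 → (x ∈ A ↔ s ≤ inner ℝ x y)) →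
      (uniformSphere d).real A = capFraction y s := by
    intro A hA
    refine measureReal_congr ?_
    filter_upwards [ae_norm_eq_one d] with x hx using propext (hA x hx)
  rcases sphereRadius_eq b with hR | hR <;> rw [hR]
  · rw [hcap _ fun x hx => ?_, hzero _ fun x hx hmem => ?_, add_zero]
    · have := hmem.1
      rw [norm_smul_of_norm_eq_one hx] at this
      norm_num at this
    · change ‖x‖ = 1 ∧ 1 * s ≤ inner ℝ x y ↔ _
      simp [hx]
  · rw [hzero _ fun x hx hmem => ?_, hcap _ fun x hx => ?_, zero_add]
    · change ‖(1.3 : ℝ) • x‖ = 1.3 ∧ 1.3 * s ≤ inner ℝ ((1.3 : ℝ) • x) y ↔ _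
      rw [norm_smul_of_norm_eq_one hx, hin, mul_le_mul_iff_right₀ (by norm_num)]
      simp
    · have := hmem.1
      rw [hx] at this
      norm_num at this

/-- Where a shift of a data point leads to an error. -/
theorem classifierOf_add_ne_iff {d : ℕ} {t : ℝ} {x y v : Vec d} (hx : ‖x‖ = 1 ∨ ‖x‖ = 1.3)
    (hv : ‖v‖ ≤ 1 / 10) (b : ℤˣ) :
    classifierOf (spheresTruth d) (capSet t (y, b)) (x + v) ≠ spheresTruth d x ↔
      ‖x‖ = sphereRadius b ∧ sphereRadius b * t ≤ inner ℝ x y + inner ℝ v y := by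
  rw [← spheresTruth_add hx hv, classifierOf_ne_iff, ← inner_add_left]
  have h1 := norm_add_le x v
  have h2 := norm_sub_le_norm_add x v
  rcases Int.units_eq_one_or b with rfl | rfl
  · rw [mem_capSet_one, show sphereRadius 1 = 1.3 from if_neg (by decide)]
    constructor
    · rintro ⟨⟨-, h3⟩, h4⟩
      refine ⟨hx.resolve_left fun hx => ?_, h3⟩
      linarith
    · rintro ⟨h3, h4⟩
      exact ⟨⟨by linarith, h4⟩, by linarith⟩
  · rw [mem_capSet_neg_one, show sphereRadius (-1) = 1 from if_pos rfl, one_mul]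
    constructor
    · rintro ⟨⟨h3, h4⟩, -⟩
      refine ⟨hx.resolve_right fun hx => ?_, h4⟩
      linarith
    · rintro ⟨h3, h4⟩
      -- The shifted point has norm at least `0.9`, which exceeds `1.15 / 1.3`.
      refine ⟨⟨by linarith, h4⟩, lt_of_lt_of_le (b := 0.9) (by norm_num) (by linarith)⟩

theorem isProbabilityMeasure_spheresData {d : ℕ} (hd : d ≠ 0) :
    IsProbabilityMeasure (spheresData d) := by
  have := isProbabilityMeasure_uniformSphere hd
  have : IsProbabilityMeasure uniformSign := ⟨uniformSign_univ⟩
  exact Measure.isProbabilityMeasure_map (measurable_spheresData_map d).aemeasurable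

/-- A perturbation of size `t` gains at most `t` in direction `y`, so only points at height at least
`R t - t` are endangered. -/
theorem advRisk_capSet_le {d : ℕ} {t : ℝ} {y : Vec d} (hy : ‖y‖ = 1) (ht : t ≤ 1 / 10) (b : ℤˣ) :
    advRisk (spheresData d) (spheresTruth d)
        (classifierOf (spheresTruth d) (capSet t (y, b))) t ≤
      1 / 2 * capFraction y (t * (sphereRadius b - 1) / sphereRadius b) := by
  have hd := ne_zero_of_norm_eq_one hy
  have := isProbabilityMeasure_spheresData hd
  rw [← spheresData_scaledCap hy _ b, advRisk]
  refine ENNReal.toReal_mono (measure_ne_top _ _) (measure_mono_ae ?_)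
  filter_upwards [ae_spheresData hd] with x hx hmem
  obtain ⟨γ, hγ, hne⟩ := hmem
  have hγ' : ‖γ‖ ≤ t := by simpa using hγ
  obtain ⟨h1, h2⟩ := (classifierOf_add_ne_iff hx (hγ'.trans ht) b).1 hne
  refine ⟨h1, ?_⟩
  have hR : 0 < sphereRadius b := by rcases sphereRadius_eq b with h | h <;> rw [h] <;> norm_num
  have h3 : inner ℝ γ y ≤ t := (real_inner_le_norm γ y).trans (by rwa [hy, mul_one])
  rw [mul_div_cancel₀ _ hR.ne']
  linarith

theorem le_advRiskOf_capSet {d : ℕ} {t η : ℝ} {y v : Vec d} (hy : ‖y‖ = 1) (ht : t ≤ 1 / 10)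
    (hv : ‖v‖ ≤ t) (hvy : t * (1 - η) ≤ inner ℝ v y) (b : ℤˣ) :
    1 / 2 * capFraction y (t * (sphereRadius b - 1 + η) / sphereRadius b) ≤
      advRiskOf (spheresData d) (spheresTruth d)
        (classifierOf (spheresTruth d) (capSet t (y, b))) fun x => x + v := by
  have hd := ne_zero_of_norm_eq_one hy
  have := isProbabilityMeasure_spheresData hd
  rw [← spheresData_scaledCap hy _ b, advRiskOf]
  refine ENNReal.toReal_mono (measure_ne_top _ _) (measure_mono_ae ?_)
  filter_upwards [ae_spheresData hd] with x hx hmem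
  obtain ⟨h1, h2⟩ := hmem
  have hR : 0 < sphereRadius b := by rcases sphereRadius_eq b with h | h <;> rw [h] <;> norm_num
  rw [mul_div_cancel₀ _ hR.ne'] at h2
  exact (classifierOf_add_ne_iff hx (hv.trans ht) b).2 ⟨h1, by linarith⟩

/-- A shift in a direction that is nearly normal to the cap does half of the possible damage. -/
theorem half_mul_advRisk_le {d : ℕ} (hd : 10000 ≤ d) {t η : ℝ} (ht : IsCapHeight d 0.01 t)
    (hη0 : 0 ≤ η) (hη : η ≤ 1 / 2000) {y v : Vec d} (hy : ‖y‖ = 1) (hv : ‖v‖ ≤ t)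
    (hvy : t * (1 - η) ≤ inner ℝ v y) (b : ℤˣ) :
    1 / 2 * advRisk (spheresData d) (spheresTruth d)
        (classifierOf (spheresTruth d) (capSet t (y, b))) t ≤
      advRiskOf (spheresData d) (spheresTruth d)
        (classifierOf (spheresTruth d) (capSet t (y, b))) fun x => x + v := by
  obtain ⟨-, hb, -⟩ := ht.bounds (by omega)
  obtain ⟨⟨ht0, -⟩, htδ⟩ := (isCapHeight_iff hy (by norm_num)).1 ht
  have hs : (100 : ℝ) ≤ Real.sqrt d :=
    Real.le_sqrt_of_sq_le (by norm_num; exact_mod_cast hd)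
  -- The bound `10000` on the dimension enters here: it keeps shifted data points within the shells
  -- of their own class.
  have ht1 : t ≤ 1 / 10 := by nlinarith
  have hup := advRisk_capSet_le hy ht1 b
  have hlow := le_advRiskOf_capSet hy ht1 hv hvy b
  have hR : 1 ≤ sphereRadius b ∧ sphereRadius b ≤ 1.3 := by
    rcases sphereRadius_eq b with h | h <;> rw [h] <;> norm_num
  have hR0 : 0 < sphereRadius b := by linarith
  set R := sphereRadius b
  have h1 : t * (R - 1 + η) / R - t * (R - 1) / R ≤ t * η := by
    rw [← sub_div, div_le_iff₀ hR0]
    nlinarith [mul_nonneg ht0 hη0]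
  have h2 : t * (R - 1) / R ≤ t := by
    rw [div_le_iff₀ hR0]
    nlinarith
  have h3 : t * (R - 1) / R ≤ t * (R - 1 + η) / R := by
    gcongr
    linarith
  have h4 : 0 ≤ t * (R - 1) / R := div_nonneg (mul_nonneg ht0 (by linarith)) hR0.le
  have h5 : t * η ≤ t * 1 := by gcongr; linarith
  have h6 := capFraction_sub_le (by omega) hy h4 h3 (by linarith)
  have h7 := capFraction_anti hy h2
  -- The misalignment costs at most `0.005`, half of the fraction `0.01` at height `t`, which lies
  -- above `t * (R - 1) / R`.
  have h8 : (t * (R - 1 + η) / R - t * (R - 1) / R) * Real.sqrt d ≤ 0.005 := by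
    calc _ ≤ t * η * Real.sqrt d := by gcongr
      _ = η * (t * Real.sqrt d) := by ring
      _ ≤ 1 / 2000 * 10 := by gcongr
      _ = 0.005 := by norm_num
  linarith


/-! ### The query points -/

/-- The sample points on the unit sphere, each followed by its multiple on the outer sphere. -/
noncomputable def queryPoints {d m : ℕ} (x : Fin m → Vec d) (n : ℕ) : Vec d :=
  if h : n / 2 < m then (if n % 2 = 0 then x ⟨n / 2, h⟩ else (1.3 : ℝ) • x ⟨n / 2, h⟩) else 0

theorem errorSum_queryPoints {d m : ℕ} {t : ℝ} {x : Fin m → Vec d} (hx : ∀ i, ‖x i‖ = 1)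
    (y : Vec d) (b : ℤˣ) :
    errorSum (queryPoints x)
        (fun n => decide (classifierOf (spheresTruth d) (capSet t (y, b)) (queryPoints x n) = 1)) m =
      (1.3 : ℝ) • sampleSum t x y := by
  rw [errorSum, Finset.sum_range, sampleSum, Finset.smul_sum]
  refine Finset.sum_congr rfl fun i _ => ?_
  have h0 : queryPoints x (2 * i) = x i := by
    simp [queryPoints]
  have h1 : queryPoints x (2 * i + 1) = (1.3 : ℝ) • x i := by
    have h : (2 * (i : ℕ) + 1) / 2 = i := by omega
    have h' : (2 * (i : ℕ) + 1) % 2 = 1 := by omega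
    simp [queryPoints, h, h']
  simp only [h0, h1, decide_eq_false_iff_not, decide_eq_true_eq]
  have hq := query_answers_iff (t := t) (y := y) (hx i) b
  by_cases h : t ≤ inner ℝ (x i) y
  · rw [if_neg (fun h' => hq.1 h' h), if_pos h]
  · rw [if_pos (hq.2 h), if_neg h, smul_zero]

/-- This is `1 - η ≤ (1 + η)^(-1/2)`, in the form `(1 - η)² (1 + η) ≤ 1`. -/
theorem IsAligned.mul_norm_le {d : ℕ} {η : ℝ} {S y : Vec d} (h : IsAligned η S y) (hη0 : 0 ≤ η)
    (hη1 : η ≤ 1) : (1 - η) * ‖S‖ ≤ inner ℝ S y := by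
  obtain ⟨h1, h2⟩ := h
  refine (sq_le_sq₀ (mul_nonneg (by linarith) (norm_nonneg _)) h1.le).1 ?_
  have h3 : (1 - η) ^ 2 * (1 + η) ≤ 1 := by nlinarith [mul_nonneg hη0 hη0]
  calc ((1 - η) * ‖S‖) ^ 2 = (1 - η) ^ 2 * ‖S‖ ^ 2 := by ring
    _ ≤ (1 - η) ^ 2 * ((1 + η) * inner ℝ S y ^ 2) := by gcongr
    _ = ((1 - η) ^ 2 * (1 + η)) * inner ℝ S y ^ 2 := by ring
    _ ≤ 1 * inner ℝ S y ^ 2 := by gcongr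
    _ = inner ℝ S y ^ 2 := one_mul _

theorem shiftAdversary_success {d m : ℕ} (hd : 10000 ≤ d) {t η : ℝ} (ht : IsCapHeight d 0.01 t)
    (hη0 : 0 ≤ η) (hη : η ≤ 1 / 2000) {x : Fin m → Vec d} (hx : ∀ i, ‖x i‖ = 1) {y : Vec d}
    (hy : ‖y‖ = 1) (hal : IsAligned η (sampleSum t x y) y) (b : ℤˣ) :
    1 / 2 * advRisk (spheresData d) (spheresTruth d)
        (classifierOf (spheresTruth d) (capSet t (y, b))) t ≤
      advRiskOf (spheresData d) (spheresTruth d)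
        (classifierOf (spheresTruth d) (capSet t (y, b)))
        ((shiftAdversary m ht.1.1 (queryPoints x)).attack
          (classifierOf (spheresTruth d) (capSet t (y, b)))) := by
  set S := sampleSum t x y
  have hS : 0 < ‖S‖ := norm_pos_iff.2 fun h => by
    have := hal.1
    simp [h] at this
  have hattack : (shiftAdversary m ht.1.1 (queryPoints x)).attack
      (classifierOf (spheresTruth d) (capSet t (y, b))) = fun z => z + (t / ‖S‖) • S := by
    ext1 z
    -- The sum found by the queries is `1.3 • S`; normalization removes the factor.
    rw [shiftAdversary_attack, errorSum_queryPoints hx, norm_smul,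
      Real.norm_of_nonneg (by norm_num : (0 : ℝ) ≤ 1.3), smul_smul]
    change z + (t / (1.3 * ‖S‖) * 1.3) • S = _
    congr 2
    field_simp
  rw [hattack]
  refine half_mul_advRisk_le hd ht hη0 hη hy ?_ ?_ b
  · rw [norm_smul, Real.norm_of_nonneg (div_nonneg ht.1.1 hS.le), div_mul_cancel₀ _ hS.ne']
  · rw [inner_smul_left, RCLike.conj_to_real, div_mul_eq_mul_div, le_div_iff₀ hS, mul_assoc]
    exact mul_le_mul_of_nonneg_left (hal.mul_norm_le hη0 (by linarith)) ht.1.1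

theorem exists_adversary {d : ℕ} (hd : 10000 ≤ d) {t : ℝ} (ht : IsCapHeight d 0.01 t) {m : ℕ}
    (hm : m = 1000000000 * d) :
    ∃ A : NonadaptiveAdversary d (2 * m) t,
      A.SucceedsOn (spheresData d) (spheresTruth d) (capLaw d) (capSet t) (1 / 2) 0.01 ∧
      A.ImplementedBy preprocess evaluate (m * (9 * d + 10) + 5 * d + 6) (7 * d + 2) := by
  have hd0 : d ≠ 0 := by omega
  have := isProbabilityMeasure_uniformSphere hd0
  have hd' : (10000 : ℝ) ≤ d := by exact_mod_cast hd
  have hmd : (m : ℝ) = 1000000000 * d := by rw [hm]; push_cast; ring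
  -- With `m = 10^9 d` the right side equals `12.5 (t² d) m`, and `t² d ≥ 0.49² ≥ 0.24` makes it at
  -- least `3 m`.
  have hη : 2 * (m : ℝ) ≤ 1 / 2000 * (t * (0.005 * m)) ^ 2 := by
    have h1 := (ht.bounds (by omega)).1
    have h2 : 0.24 ≤ t ^ 2 * d := by
      have : (0.49 : ℝ) ^ 2 ≤ (t * Real.sqrt d) ^ 2 := by gcongr
      rw [mul_pow, Real.sq_sqrt (by positivity)] at this
      linarith
    calc 2 * (m : ℝ) ≤ 12.5 * 0.24 * m := by
          have : (0 : ℝ) ≤ m := Nat.cast_nonneg m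
          linarith
      _ ≤ 12.5 * (t ^ 2 * d) * m := by gcongr
      _ = 1 / 2000 * (t * (0.005 * m)) ^ 2 := by rw [hmd]; ring
  obtain ⟨x, hx, hgood⟩ := exists_sample (by omega) ht (by omega) hη
  refine ⟨shiftAdversary m ht.1.1 (queryPoints x), ?_, shiftAdversary_implementedBy _ _⟩
  refine le_trans ?_ hgood
  have hnull : uniformSphere d {y | ¬ ‖y‖ = 1} = 0 := ae_iff.1 (ae_norm_eq_one d)
  -- Failure forces `y` into a bad set not depending on `b`; monotonicity of outer measure suffices,
  -- so the failure event need not be measurable.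
  calc _ ≤ (uniformSphere d).prod uniformSign
          (({y | ¬ IsAligned (1 / 2000) (sampleSum t x y) y} ∪ {y | ¬ ‖y‖ = 1}) ×ˢ Set.univ) := by
        refine measure_mono ?_
        rintro ⟨y, b⟩ hz
        refine ⟨?_, trivial⟩
        by_contra hcon
        rw [Set.mem_union, not_or] at hcon
        exact hz (shiftAdversary_success hd ht (by norm_num) le_rfl hx (not_not.1 hcon.2)
          (not_not.1 hcon.1) b)
    _ ≤ uniformSphere d {y | ¬ IsAligned (1 / 2000) (sampleSum t x y) y} := by
        have : IsProbabilityMeasure uniformSign := ⟨uniformSign_univ⟩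
        rw [Measure.prod_prod, uniformSign_univ, mul_one]
        exact (measure_union_le _ _).trans_eq (by rw [hnull, add_zero])

end ConcentricSpheres

open ConcentricSpheres
theorem mainTheorem5 :
    ∃ (pre eval : Command) (q T T' : ℕ → ℕ),
      (fun d => (q d : ℝ)) =Θ[atTop] (fun d => (d : ℝ)) ∧
      (fun d => (T d : ℝ)) =O[atTop] (fun d => (d : ℝ) ^ 2) ∧
      (fun d => (T' d : ℝ)) =O[atTop] (fun d => (d : ℝ)) ∧
      ∃ d₀ : ℕ, ∀ d ≥ d₀,
        (∃! t, IsCapHeight d 0.01 t) ∧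
        ∀ t, IsCapHeight d 0.01 t →
          ∃ A : NonadaptiveAdversary d (q d) t,
            A.SucceedsOn (spheresData d) (spheresTruth d) (capLaw d) (capSet t) (1 / 2) 0.01 ∧
            A.ImplementedBy pre eval (T d) (T' d) := by
  refine ⟨preprocess, evaluate, fun d => 2 * (1000000000 * d),
    fun d => 1000000000 * d * (9 * d + 10) + 5 * d + 6, fun d => 7 * d + 2, ?_, ?_, ?_,
    10000, fun d hd => ⟨existsUnique_isCapHeight (by omega), fun t ht =>
      exists_adversary hd ht rfl⟩⟩
  · refine ⟨IsBigO.of_bound 2000000000 (Eventually.of_forall fun d => ?_),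
      IsBigO.of_bound 1 (Eventually.of_forall fun d => ?_)⟩
    · rw [Real.norm_natCast, Real.norm_natCast]
      push_cast
      linarith
    · rw [Real.norm_natCast, Real.norm_natCast]
      push_cast
      linarith [(Nat.cast_nonneg d : (0 : ℝ) ≤ d)]
  · refine IsBigO.of_bound 20000000000 ((eventually_ge_atTop 1).mono fun d hd => ?_)
    have hd' : (1 : ℝ) ≤ d := by exact_mod_cast hd
    rw [Real.norm_natCast, norm_pow, Real.norm_natCast]
    push_cast
    nlinarith
  · refine IsBigO.of_bound 9 ((eventually_ge_atTop 1).mono fun d hd => ?_)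
    have hd' : (1 : ℝ) ≤ d := by exact_mod_cast hd
    rw [Real.norm_natCast, Real.norm_natCast]
    push_cast
    linarith
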